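/- Let $g\in L^2(\mathbb{R})$ (complex valued) and let $\Lambda\subset\mathbb{R}^2$ be uniformly discrete, i.e. there is $\delta>0$ such that $\mathrm{dist}(x,y)>\delta$ for all distinct $x,y\in\Lambda$. Let $$G(g,\Lambda)=\{e^{2\pi i\mu t}g(t-\lambda)\}_{(\lambda,\mu)\in\Lambda}\subset L^2(\mathbb{R})$$ be the corresponding Gabor system, and let $Q_{(a,b)}(R)=\{(x,y)\in\mathbb{R}^2:|x-a|\le R,\ |y-b|\le R\}$. Then the limits $$D^+(\Lambda):=\lim_{R\to\infty}\frac{\max_{(a,b)\in\mathbb{R}^2}|\Lambda\cap Q_{(a,b)}(R)|}{(2R)^2},\qquad D^-(\Lambda):=\lim_{R\to\infty}\frac{\min_{(a,b)\in\mathbb{R}^2}|\Lambda\cap Q_{(a,b)}(R)|}{(2R)^2}$$ (the upper and lower Beurling densities of $\Lambda$, where $|\cdot|$ is the number of points) exist and are finite, and: 1. If $G(g,\Lambda)$ is a Riesz sequence, then $D^+(\Lambda)\le 1$. 2. If $G(g,\Lambda)$ is a frame of $L^2(\mathbb{R})$, then $D^-(\Lambda)\ge 1$. Here a family $\{f_n\}$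 in a Hilbert space $H$ is a frame if there are constants $A,B>0$ with $A\|f\|^2\le\sum_n|\langle f,f_n\rangle|^2\le B\|f\|^2$ for all $f\in H$; it is a Riesz basis of $H$ if there are an orthonormal basis $\{e_n\}$ of $H$ and a bounded invertible operator $T:H\to H$ with $f_n=Te_n$ for all $n$; and it is a Riesz sequence if it is a Riesz basis of the closure of its linear span. -/

import Mathlib

open MeasureTheory Filter Topology
open scoped NNReal ENNReal

noncomputable section

namespace Gabor

/-- The complex Hilbert space `L²(ℝ)`. -/
abbrev L2 : Type := Lp ℂ 2 (volume : Measure ℝ)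

/-- The time-frequency shift `t ↦ e^{2πiμt} g(t - lam)` of a function on the line. -/
def timeFreqShift (lam mu : ℝ) (g : ℝ → ℂ) (t : ℝ) : ℂ :=
  Complex.exp (2 * Real.pi * Complex.I * mu * t) * g (t - lam)

/-- Time-frequency shifts preserve square integrability. -/
theorem memLp_timeFreqShift (lam mu : ℝ) {g : ℝ → ℂ} (hg : MemLp g 2 volume) :
    MemLp (timeFreqShift lam mu g) 2 volume := by
  have h1 : MemLp (fun t => g (t - lam)) 2 volume :=
    hg.comp_measurePreserving (measurePreserving_sub_right volume lam)
  refine h1.of_le ?_ (Eventually.of_forall fun t => ?_)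
  · exact (Continuous.aestronglyMeasurable (by fun_prop)).mul h1.1
  · have h2 : (2 * Real.pi * Complex.I * mu * t : ℂ)
        = ((2 * Real.pi * mu * t : ℝ) : ℂ) * Complex.I := by
      push_cast; ring
    simp only [timeFreqShift, norm_mul]
    rw [h2, Complex.norm_exp_ofReal_mul_I, one_mul]

/-- The element `e^{2πiμt} g(t - lam)` of `L²(ℝ)`, where `p = (lam, mu)`. -/
def atom (g : L2) (p : ℝ × ℝ) : L2 :=
  (memLp_timeFreqShift p.1 p.2 (Lp.memLp g)).toLp (timeFreqShift p.1 p.2 g)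

/-- The Gabor system `G(g, Λ)`, as a family indexed by the points of `Λ`. -/
def gaborSystem (g : L2) (Λ : Set (ℝ × ℝ)) : Λ → L2 := fun p => atom g p

section Systems

variable {ι : Type*} {H : Type*} [NormedAddCommGroup H] [InnerProductSpace ℂ H]

/-- A family is a frame if its frame inequalities hold for some positive constants. -/
def IsFrame (f : ι → H) : Prop :=
  ∃ A B : ℝ, 0 < A ∧ 0 < B ∧ ∀ x : H,
    Summable (fun i => ‖inner ℂ x (f i)‖ ^ 2) ∧
    A * ‖x‖ ^ 2 ≤ ∑' i, ‖inner ℂ x (f i)‖ ^ 2 ∧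
    ∑' i, ‖inner ℂ x (f i)‖ ^ 2 ≤ B * ‖x‖ ^ 2

/-- A Riesz basis: the image of an orthonormal basis under a bounded invertible operator. -/
def IsRieszBasis (f : ι → H) : Prop :=
  ∃ (e : HilbertBasis ι ℂ H) (T : H ≃L[ℂ] H), ∀ i, f i = T (e i)

/-- The closed linear span of a family. -/
def closedSpan (f : ι → H) : Submodule ℂ H :=
  (Submodule.span ℂ (Set.range f)).topologicalClosure

theorem mem_closedSpan (f : ι → H) (i : ι) : f i ∈ closedSpan f :=
  Submodule.le_topologicalClosure _ (Submodule.subset_span ⟨i, rfl⟩)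

/-- A Riesz sequence: a family that is a Riesz basis of its closed linear span. -/
def IsRieszSequence (f : ι → H) : Prop :=
  IsRieszBasis (fun i => (⟨f i, mem_closedSpan f i⟩ : closedSpan f))

end Systems

/-- `Λ` is uniformly discrete: distinct points have Euclidean distance above some `δ > 0`. -/
def UniformlyDiscrete (Λ : Set (ℝ × ℝ)) : Prop :=
  ∃ δ : ℝ, 0 < δ ∧ ∀ p ∈ Λ, ∀ q ∈ Λ, p ≠ q →
    δ < Real.sqrt ((p.1 - q.1) ^ 2 + (p.2 - q.2) ^ 2)

/-- The closed square with center `c` and side length `2R`. -/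
def square (c : ℝ × ℝ) (R : ℝ) : Set (ℝ × ℝ) :=
  {p | |p.1 - c.1| ≤ R ∧ |p.2 - c.2| ≤ R}

/-- The largest number of points of `Λ` in a square of side length `2R`. -/
def maxCount (Λ : Set (ℝ × ℝ)) (R : ℝ) : ℕ∞ := ⨆ c : ℝ × ℝ, (Λ ∩ square c R).encard

/-- The smallest number of points of `Λ` in a square of side length `2R`. -/
def minCount (Λ : Set (ℝ × ℝ)) (R : ℝ) : ℕ∞ := ⨅ c : ℝ × ℝ, (Λ ∩ square c R).encard

/-- The limit defining the upper Beurling density of `Λ` exists and equals `D`. -/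
def HasUpperDensity (Λ : Set (ℝ × ℝ)) (D : ℝ≥0) : Prop :=
  Tendsto (fun R : ℝ => (maxCount Λ R : ℝ≥0∞) / ENNReal.ofReal ((2 * R) ^ 2)) atTop
    (𝓝 (D : ℝ≥0∞))

/-- The limit defining the lower Beurling density of `Λ` exists and equals `D`. -/
def HasLowerDensity (Λ : Set (ℝ × ℝ)) (D : ℝ≥0) : Prop :=
  Tendsto (fun R : ℝ => (minCount Λ R : ℝ≥0∞) / ENNReal.ofReal ((2 * R) ^ 2)) atTop
    (𝓝 (D : ℝ≥0∞))

end Gabor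

end

noncomputable section

namespace Gabor

/-! The proof counts dimensions against a reference system of density one. The indicator of the unit
interval generates an orthonormal basis `latticeAtom` over `ℤ × ℤ`. For each ε there is an R such
that, on all squares, the points of Λ and of the lattice can be compared up to a factor 1 - ε and an
enlargement of the square by R. Dividing by the area, then letting the square grow and ε tend to 0,
gives both inequalities.

The comparison rests on `card_le_finrank_of_biorthogonal`: if n vectors have a biorthogonal system
bounded by C and lie within ε of a finite-dimensional W, then computing the trace of a product of
two projections in two ways gives (1 - Cε) n ≤ dim W.

For a Riesz sequence, the vectors are the atoms at points of Λ in a square, and W is spanned by the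
lattice atoms in the enlarged square. Closeness is uniform because shifts act continuously on L², so
one finite box of lattice atoms serves a whole compact unit cell, and integer shifts permute the
lattice atoms up to phases (`exists_latticeSpan_approximation`).

For a frame the roles are exchanged: the vectors are lattice atoms, and W is spanned by the
canonical dual vectors of the points of Λ in the enlarged square. By `IsFrame.exists_dual` the
distance to W is controlled by the frame coefficients at the remaining points, so these tails must
be uniformly small. The indicator is too poorly localized in frequency for that; it is approximated
by a smooth window on each half interval, for which `IsSmoothWindow.tail_small` holds.

The limits exist by Fekete's lemma, since counts are sub- or superadditive under tiling. -/

/-! ### Algebra of time-frequency shifts -/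

theorem coeFn_atom (g : L2) (p : ℝ × ℝ) : atom g p =ᵐ[volume] timeFreqShift p.1 p.2 g :=
  MemLp.coeFn_toLp _

theorem timeFreqShift_congr (lam mu : ℝ) {f g : ℝ → ℂ} (h : f =ᵐ[volume] g) :
    timeFreqShift lam mu f =ᵐ[volume] timeFreqShift lam mu g := by
  have := (measurePreserving_sub_right volume lam).quasiMeasurePreserving.ae_eq_comp h
  filter_upwards [this] with t ht
  simp only [timeFreqShift]
  simp only [Function.comp_apply] at ht
  rw [ht]

/-- The unimodular factor `e^{2πix}`. -/
def phase (x : ℝ) : ℂ := Complex.exp (2 * Real.pi * Complex.I * x)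

theorem norm_phase (x : ℝ) : ‖phase x‖ = 1 := by
  have h2 : (2 * Real.pi * Complex.I * x : ℂ) = ((2 * Real.pi * x : ℝ) : ℂ) * Complex.I := by
    push_cast; ring
  rw [phase, h2, Complex.norm_exp_ofReal_mul_I]

theorem phase_add (x y : ℝ) : phase (x + y) = phase x * phase y := by
  rw [phase, phase, phase, ← Complex.exp_add]; congr 1; push_cast; ring

theorem phase_zero : phase 0 = 1 := by simp [phase]

theorem conj_phase (x : ℝ) : (starRingEnd ℂ) (phase x) = phase (-x) := by
  rw [phase, phase, ← Complex.exp_conj]; simp [map_ofNat]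

theorem timeFreqShift_eq (lam mu : ℝ) (g : ℝ → ℂ) (t : ℝ) :
    timeFreqShift lam mu g t = phase (mu * t) * g (t - lam) := by
  rw [timeFreqShift, phase]; congr 2; push_cast; ring

theorem coeFn_atom_eq (g : L2) (p : ℝ × ℝ) :
    atom g p =ᵐ[volume] fun t => phase (p.2 * t) * g (t - p.1) := by
  filter_upwards [coeFn_atom g p] with t ht
  rw [ht, timeFreqShift_eq]

theorem atom_add (f g : L2) (p : ℝ × ℝ) : atom (f + g) p = atom f p + atom g p := by
  apply Lp.ext
  filter_upwards [coeFn_atom (f + g) p, Lp.coeFn_add (atom f p) (atom g p), coeFn_atom f p,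
    coeFn_atom g p, timeFreqShift_congr p.1 p.2 (Lp.coeFn_add f g)] with t h1 h2 h3 h4 h5
  rw [h1, h2, h5, Pi.add_apply, h3, h4]
  simp [timeFreqShift, mul_add]

theorem atom_smul (c : ℂ) (g : L2) (p : ℝ × ℝ) : atom (c • g) p = c • atom g p := by
  apply Lp.ext
  filter_upwards [coeFn_atom (c • g) p, Lp.coeFn_smul c (atom g p),
    coeFn_atom g p, timeFreqShift_congr p.1 p.2 (Lp.coeFn_smul c g)] with t h1 h2 h4 h5
  rw [h1, h2, h5, Pi.smul_apply, h4]
  simp [timeFreqShift, mul_left_comm]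

theorem norm_atom (g : L2) (p : ℝ × ℝ) : ‖atom g p‖ = ‖g‖ := by
  rw [Lp.norm_def, Lp.norm_def]
  congr 1
  rw [eLpNorm_congr_ae (coeFn_atom_eq g p)]
  have h := (measurePreserving_sub_right (volume : Measure ℝ) p.1)
  rw [← eLpNorm_comp_measurePreserving (Lp.aestronglyMeasurable g) h]
  apply eLpNorm_congr_norm_ae
  filter_upwards with t
  simp [norm_phase]

/-- Time-frequency shifts as linear isometries of `L²(ℝ)`. -/
def shiftIsometry (p : ℝ × ℝ) : L2 →ₗᵢ[ℂ] L2 where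
  toFun g := atom g p
  map_add' f g := atom_add f g p
  map_smul' c g := atom_smul c g p
  norm_map' g := norm_atom g p

theorem atom_sub (f g : L2) (p : ℝ × ℝ) : atom (f - g) p = atom f p - atom g p :=
  map_sub (shiftIsometry p) f g

theorem atom_atom (g : L2) (p q : ℝ × ℝ) :
    atom (atom g q) p = phase (-(q.2 * p.1)) • atom g (p + q) := by
  apply Lp.ext
  filter_upwards [coeFn_atom_eq (atom g q) p,
    (measurePreserving_sub_right volume p.1).quasiMeasurePreserving.ae_eq_comp (coeFn_atom_eq g q),
    Lp.coeFn_smul (phase (-(q.2 * p.1))) (atom g (p + q)), coeFn_atom_eq g (p + q)]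
    with t h1 h2 h3 h4
  simp only [Function.comp_apply] at h2
  rw [h1, h2, h3, Pi.smul_apply, h4, smul_eq_mul, ← mul_assoc, ← mul_assoc, ← phase_add,
    ← phase_add]
  congr 1
  · congr 1; simp; ring
  · congr 1; simp; ring

theorem atom_zero (g : L2) : atom g 0 = g := by
  apply Lp.ext
  filter_upwards [coeFn_atom_eq g 0] with t ht
  simp [ht, phase_zero]

theorem inner_atom_atom (f g : L2) (p : ℝ × ℝ) : inner ℂ (atom f p) (atom g p) = inner ℂ f g :=
  (shiftIsometry p).inner_map_map f g

/-- Covariance: up to phase only the difference of the two positions matters, which makes the later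
estimates uniform in position. -/
theorem norm_inner_atom_atom (f g : L2) (p q : ℝ × ℝ) :
    ‖inner ℂ (atom f p) (atom g q)‖ = ‖inner ℂ (atom f (p - q)) g‖ := by
  rw [← inner_atom_atom (atom f (p - q)) g q, atom_atom, inner_smul_left]
  simp [norm_phase]

/-! ### The Gabor orthonormal basis of the unit interval -/

theorem inner_eq_integral (f g : L2) :
    inner ℂ f g = ∫ t, (starRingEnd ℂ) (f t) * g t := by
  rw [L2.inner_def]
  apply integral_congr_ae
  filter_upwards with t
  rw [RCLike.inner_apply, mul_comm]

theorem continuous_phase : Continuous phase := by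
  unfold phase; fun_prop

theorem phase_intCast (n : ℤ) : phase n = 1 := by
  rw [phase, show (2 * Real.pi * Complex.I * ((n : ℝ) : ℂ) : ℂ) = n * (2 * Real.pi * Complex.I) by
    push_cast; ring]
  exact Complex.exp_int_mul_two_pi_mul_I n

theorem integral_phase (m k : ℤ) :
    ∫ t in Set.Ioc (m : ℝ) (m + 1), phase (k * t) = if k = 0 then 1 else 0 := by
  rw [← intervalIntegral.integral_of_le (by linarith)]
  split_ifs with hk
  · simp [hk, phase_zero]
  · have hc : (2 * Real.pi * Complex.I * k : ℂ) ≠ 0 := by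
      simp [Real.pi_ne_zero, hk]
    have h : ∀ t : ℝ, phase (k * t) = Complex.exp ((2 * Real.pi * Complex.I * k : ℂ) * t) := by
      intro t; rw [phase]; congr 1; push_cast; ring
    have h1 : phase (k * (m : ℝ)) = 1 := by exact_mod_cast phase_intCast (k * m)
    have h2 : phase (k * ((m : ℝ) + 1)) = 1 := by exact_mod_cast phase_intCast (k * (m + 1))
    simp_rw [h]
    rw [integral_exp_mul_complex hc, ← h, ← h, h1, h2]
    simp

/-- The indicator function of the unit interval. -/
def box : L2 :=
  indicatorConstLp 2 (measurableSet_Ioc : MeasurableSet (Set.Ioc (0 : ℝ) 1)) (by simp) (1 : ℂ)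

/-- The Gabor system of the unit interval over the integer lattice. -/
def latticeAtom (k : ℤ × ℤ) : L2 := atom box (k.1, k.2)

theorem coeFn_box : box =ᵐ[volume] Set.indicator (Set.Ioc (0 : ℝ) 1) (fun _ => (1 : ℂ)) :=
  indicatorConstLp_coeFn

theorem coeFn_latticeAtom (k : ℤ × ℤ) : latticeAtom k =ᵐ[volume]
    Set.indicator (Set.Ioc (k.1 : ℝ) (k.1 + 1)) (fun t => phase (k.2 * t)) := by
  filter_upwards [coeFn_atom_eq box (k.1, k.2),
    (measurePreserving_sub_right volume (k.1 : ℝ)).quasiMeasurePreserving.ae_eq_comp coeFn_box]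
    with t h1 h2
  simp only [Function.comp_apply] at h2
  rw [latticeAtom, h1]
  simp only [h2, Set.indicator, Set.mem_Ioc, sub_pos, sub_le_iff_le_add']
  simp

theorem inner_latticeAtom_left (k : ℤ × ℤ) (g : L2) :
    inner ℂ (latticeAtom k) g = ∫ t in Set.Ioc (k.1 : ℝ) (k.1 + 1), phase (-(k.2 * t)) * g t := by
  rw [inner_eq_integral, ← integral_indicator measurableSet_Ioc]
  apply integral_congr_ae
  filter_upwards [coeFn_latticeAtom k] with t ht
  rw [ht]
  by_cases h : t ∈ Set.Ioc (k.1 : ℝ) (k.1 + 1)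
  · simp [h, conj_phase]
  · simp [h]

theorem orthonormal_latticeAtom : Orthonormal ℂ latticeAtom := by
  rw [orthonormal_iff_ite]
  rintro ⟨m, n⟩ ⟨m', n'⟩
  rw [inner_latticeAtom_left]
  by_cases hm : m = m'
  · subst hm
    have : ∫ t in Set.Ioc (m : ℝ) (m + 1), phase (-(n * t)) * latticeAtom (m, n') t
        = ∫ t in Set.Ioc (m : ℝ) (m + 1), phase ((n' - n : ℤ) * t) := by
      apply setIntegral_congr_ae measurableSet_Ioc
      filter_upwards [coeFn_latticeAtom (m, n')] with t ht hmem
      rw [ht, Set.indicator_of_mem hmem, ← phase_add]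
      congr 1; push_cast; ring
    simp only [this, integral_phase]
    by_cases hn : n = n'
    · simp [hn]
    · have : n' - n ≠ 0 := by omega
      simp [hn, this]
  · rw [if_neg (by simp [hm])]
    rw [← integral_zero ℝ ℂ (μ := volume.restrict (Set.Ioc (m : ℝ) (m + 1)))]
    apply setIntegral_congr_ae measurableSet_Ioc
    filter_upwards [coeFn_latticeAtom (m', n')] with t ht hmem
    rw [ht, Set.indicator_of_notMem, mul_zero]
    rintro ⟨h1, h2⟩
    obtain ⟨h3, h4⟩ := hmem
    apply hm
    have a : (m : ℝ) < m' + 1 := by linarith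
    have b : (m' : ℝ) < m + 1 := by linarith
    norm_cast at a b
    omega

/-- On each unit interval these inner products are the Fourier coefficients of g, so Parseval forces
g to vanish there. -/
theorem eq_zero_of_inner_latticeAtom (g : L2) (h : ∀ k, inner ℂ (latticeAtom k) g = 0) :
    g = 0 := by
  have key : ∀ m : ℤ, ∀ᵐ t : ℝ, t ∈ Set.Ioc (m : ℝ) (m + 1) → g t = 0 := by
    intro m
    have hab : (m : ℝ) < m + 1 := by linarith
    have hL2 : MemLp g 2 (volume.restrict (Set.Ioc (m : ℝ) (m + 1))) :=
      (Lp.memLp g).restrict _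
    have hs := hasSum_sq_fourierCoeffOn hab hL2
    have hz : ∀ n : ℤ, fourierCoeffOn hab g n = 0 := by
      intro n
      rw [fourierCoeffOn_eq_integral, intervalIntegral.integral_of_le hab.le]
      have := h (m, n)
      rw [inner_latticeAtom_left] at this
      rw [← smul_zero (1 / ((m : ℝ) + 1 - m)), ← this]
      congr 1
      apply integral_congr_ae
      filter_upwards with t
      rw [fourier_coe_apply, smul_eq_mul, phase]
      congr 2
      push_cast
      have : (m : ℂ) + 1 - m = 1 := by ring
      rw [this]; ring
    simp only [hz, norm_zero, ne_eq, OfNat.ofNat_ne_zero, not_false_eq_true, zero_pow] at hs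
    have h0 := hs.unique hasSum_zero
    rw [show (m : ℝ) + 1 - m = 1 by ring, inv_one, one_smul,
      intervalIntegral.integral_of_le hab.le] at h0
    have hint : Integrable (fun x => ‖g x‖ ^ 2) (volume.restrict (Set.Ioc (m : ℝ) (m + 1))) := by
      have := hL2.integrable_norm_pow (by norm_num)
      simpa using this
    rw [integral_eq_zero_iff_of_nonneg (fun _ => by positivity) hint] at h0
    rw [Filter.EventuallyEq, ae_restrict_iff' measurableSet_Ioc] at h0
    filter_upwards [h0] with t ht hmem
    simpa using ht hmem
  rw [← ae_all_iff] at key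
  apply Lp.ext
  filter_upwards [key, Lp.coeFn_zero ℂ 2 (volume : Measure ℝ)] with t ht h0
  rw [h0]
  refine ht (⌈t⌉ - 1) ⟨?_, ?_⟩
  · push_cast
    linarith [Int.ceil_lt_add_one t]
  · push_cast
    linarith [Int.le_ceil t]

theorem span_latticeAtom_orthogonal : (Submodule.span ℂ (Set.range latticeAtom))ᗮ = ⊥ := by
  rw [Submodule.eq_bot_iff]
  intro g hg
  apply eq_zero_of_inner_latticeAtom
  intro k
  exact (Submodule.mem_orthogonal _ _).1 hg _ (Submodule.subset_span ⟨k, rfl⟩)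

/-- The Gabor orthonormal basis generated by the unit interval. -/
def latticeBasis : HilbertBasis (ℤ × ℤ) ℂ L2 :=
  HilbertBasis.mkOfOrthogonalEqBot orthonormal_latticeAtom span_latticeAtom_orthogonal

theorem latticeBasis_apply (k : ℤ × ℤ) : latticeBasis k = latticeAtom k := by
  rw [latticeBasis, HilbertBasis.coe_mkOfOrthogonalEqBot]

/-! ### Strong continuity of time-frequency shifts -/

theorem continuous_atom (g : L2) : Continuous (atom g) := by
  have htrans : Continuous fun x : ℝ => atom g (x, 0) := by
    let F : C(ℝ, C(ℝ, ℝ)) := (ContinuousMap.mk (fun a : ℝ × ℝ => a.2 - a.1) (by fun_prop)).curry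
    have hF : ∀ x, MeasurePreserving (F x) volume volume := fun x =>
      measurePreserving_sub_right volume x
    have := Continuous.compMeasurePreservingLp (f := fun _ : ℝ => g) continuous_const
      F.continuous hF (by simp)
    convert this using 2 with x
    apply Lp.ext
    filter_upwards [coeFn_atom_eq g (x, 0), Lp.coeFn_compMeasurePreserving g (hF x)] with t h1 h2
    rw [h1, h2]
    simp [phase_zero, F]
  have hmod : ∀ h : L2, Continuous fun y : ℝ => atom h (0, y) := by
    intro h
    -- Weak continuity follows from dominated convergence. Since modulation preserves the norm, it
    -- upgrades to norm continuity by expanding the square of the difference.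
    have hinner : ∀ k : L2, Continuous fun y : ℝ => (inner ℂ (atom h (0, y)) k : ℂ) := by
      intro k
      have heq : ∀ y : ℝ, (inner ℂ (atom h (0, y)) k : ℂ)
          = ∫ t, phase (-(y * t)) * ((starRingEnd ℂ) (h t) * k t) := by
        intro y
        rw [inner_eq_integral]
        apply integral_congr_ae
        filter_upwards [coeFn_atom_eq h (0, y)] with t ht
        rw [ht]
        simp [conj_phase, mul_assoc]
      simp_rw [heq]
      have hi : Integrable (fun t => (starRingEnd ℂ) (h t) * k t) volume := by
        have := L2.integrable_inner (𝕜 := ℂ) h k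
        simpa [RCLike.inner_apply, mul_comm] using this
      refine continuous_of_dominated (bound := fun t => ‖(starRingEnd ℂ) (h t) * k t‖) ?_ ?_
        hi.norm ?_
      · intro y
        exact (Continuous.aestronglyMeasurable
          (continuous_phase.comp (by fun_prop))).mul hi.aestronglyMeasurable
      · intro y
        filter_upwards with t
        rw [norm_mul, norm_phase, one_mul]
      · filter_upwards with t
        exact (continuous_phase.comp (by fun_prop)).mul continuous_const
    rw [continuous_iff_continuousAt]
    intro y0
    rw [ContinuousAt, tendsto_iff_norm_sub_tendsto_zero]
    have hsq : Tendsto (fun y => ‖atom h (0, y) - atom h (0, y0)‖ ^ 2) (𝓝 y0) (𝓝 0) := by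
      have heq : ∀ y, ‖atom h (0, y) - atom h (0, y0)‖ ^ 2
          = ‖h‖ ^ 2 - 2 * RCLike.re (inner ℂ (atom h (0, y)) (atom h (0, y0)) : ℂ) + ‖h‖ ^ 2 := by
        intro y
        rw [@norm_sub_sq ℂ, norm_atom, norm_atom]
      simp_rw [heq]
      have hc : Continuous fun y => ‖h‖ ^ 2
          - 2 * RCLike.re (inner ℂ (atom h (0, y)) (atom h (0, y0)) : ℂ) + ‖h‖ ^ 2 :=
        (continuous_const.sub (continuous_const.mul
          (RCLike.continuous_re.comp (hinner (atom h (0, y0)))))).add continuous_const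
      have := hc.tendsto y0
      rwa [inner_self_eq_norm_sq, norm_atom, show ‖h‖ ^ 2 - 2 * ‖h‖ ^ 2 + ‖h‖ ^ 2 = 0 by ring]
        at this
    have := hsq.sqrt
    simpa using this
  have hcomp : ∀ p : ℝ × ℝ, atom g p = atom (atom g (p.1, 0)) (0, p.2) := by
    intro p
    rw [atom_atom]
    simp [phase_zero]
  rw [continuous_iff_continuousAt]
  intro p0
  rw [ContinuousAt, tendsto_iff_norm_sub_tendsto_zero]
  have h1 : Tendsto (fun p : ℝ × ℝ => ‖atom g (p.1, 0) - atom g (p0.1, 0)‖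
      + ‖atom (atom g (p0.1, 0)) (0, p.2) - atom (atom g (p0.1, 0)) (0, p0.2)‖) (𝓝 p0) (𝓝 0) := by
    have : Continuous (fun p : ℝ × ℝ => ‖atom g (p.1, 0) - atom g (p0.1, 0)‖
      + ‖atom (atom g (p0.1, 0)) (0, p.2) - atom (atom g (p0.1, 0)) (0, p0.2)‖) :=
      (((htrans.comp continuous_fst).sub continuous_const).norm).add
        ((((hmod _).comp continuous_snd).sub continuous_const).norm)
    simpa using this.tendsto p0
  refine squeeze_zero (fun _ => norm_nonneg _) (fun p => ?_) h1
  rw [hcomp p, hcomp p0]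
  have : atom (atom g (p.1, 0)) (0, p.2) - atom (atom g (p0.1, 0)) (0, p0.2)
      = atom (atom g (p.1, 0) - atom g (p0.1, 0)) (0, p.2)
        + (atom (atom g (p0.1, 0)) (0, p.2) - atom (atom g (p0.1, 0)) (0, p0.2)) := by
    rw [atom_sub]; abel
  rw [this]
  refine (norm_add_le _ _).trans ?_
  rw [norm_atom]

/-! ### Smooth windows and their lattice coefficients -/

/-- A window supported in the first half of the unit interval whose Fourier transform decays
quadratically. -/
def IsSmoothWindow (f : L2) : Prop :=
  ∃ φ : ℝ → ℂ, f =ᵐ[volume] φ ∧ (∀ t, t ∉ Set.Ioo (0 : ℝ) (1 / 2) → φ t = 0) ∧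
    ∃ C : ℝ, 0 ≤ C ∧ ∀ y : ℝ, ‖∫ t, phase (y * t) * φ t‖ ≤ C / (1 + y ^ 2)

theorem exists_fourier_decay {φ : ℝ → ℂ} (h : HasCompactSupport φ) (hc : ContDiff ℝ (⊤ : ℕ∞) φ) :
    ∃ C : ℝ, 0 ≤ C ∧ ∀ y : ℝ, ‖∫ t, phase (y * t) * φ t‖ ≤ C / (1 + y ^ 2) := by
  let ψ : SchwartzMap ℝ ℂ := FourierTransform.fourier (h.toSchwartzMap hc)
  obtain ⟨C0, h0, hC0⟩ := ψ.decay 0 0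
  obtain ⟨C2, h2, hC2⟩ := ψ.decay 2 0
  refine ⟨C0 + C2, by positivity, fun y => ?_⟩
  have hy : ∫ t, phase (y * t) * φ t = ψ (-y) := by
    have : ψ (-y) = FourierTransform.fourier φ (-y) := by
      simp only [ψ, SchwartzMap.fourier_coe]
      rfl
    rw [this, Real.fourier_real_eq_integral_exp_smul]
    congr 1
    ext t
    rw [phase, smul_eq_mul]
    congr 2
    push_cast; ring
  rw [hy, le_div_iff₀ (by positivity)]
  have a := hC0 (-y)
  have b := hC2 (-y)
  simp only [norm_iteratedFDeriv_zero, pow_zero, one_mul, norm_neg, Real.norm_eq_abs, sq_abs] at a b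
  linarith

theorem exists_isSmoothWindow {ε : ℝ} (hε : 0 < ε) :
    ∃ f : L2, IsSmoothWindow f ∧ ‖box - (f + atom f (1 / 2, 0))‖ ≤ ε := by
  -- The bound 1/8 keeps the inner radius 1/4 - δ positive. The bound ε²/8 makes the exceptional
  -- set, of measure at most 2δ, contribute at most ε/2 in norm for each of the two halves.
  set δ : ℝ := min (1 / 8) (ε ^ 2 / 8) with hδ
  have hδ0 : 0 < δ := by positivity
  have hδ1 : δ ≤ 1 / 8 := min_le_left _ _
  have hδ2 : δ ≤ ε ^ 2 / 8 := min_le_right _ _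
  let β : ContDiffBump (1 / 4 : ℝ) := ⟨1 / 4 - δ, 1 / 4, by linarith, by linarith⟩
  let φ : ℝ → ℂ := fun t => (β t : ℂ)
  have hcont : ContDiff ℝ (⊤ : ℕ∞) φ := Complex.ofRealCLM.contDiff.comp β.contDiff
  have hsupp : HasCompactSupport φ := β.hasCompactSupport.comp_left Complex.ofReal_zero
  have hzero : ∀ t, t ∉ Set.Ioo (0 : ℝ) (1 / 2) → φ t = 0 := by
    intro t ht
    have : β t = 0 := by
      apply β.zero_of_le_dist
      by_contra hlt
      apply ht
      rw [not_le, Real.dist_eq, abs_lt] at hlt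
      constructor <;> simp only [β] at hlt <;> linarith [hlt.1, hlt.2]
    simp [φ, this]
  have hmem : MemLp φ 2 volume := hcont.continuous.memLp_of_hasCompactSupport hsupp
  let f : L2 := hmem.toLp φ
  have hf : f =ᵐ[volume] φ := hmem.coeFn_toLp
  refine ⟨f, ⟨φ, hf, hzero, exists_fourier_decay hsupp hcont⟩, ?_⟩
  let half : L2 := indicatorConstLp 2
    (measurableSet_Ioc : MeasurableSet (Set.Ioc (0 : ℝ) (1 / 2))) (by simp) (1 : ℂ)
  have hhalf : half =ᵐ[volume] Set.indicator (Set.Ioc (0 : ℝ) (1 / 2)) (fun _ => (1 : ℂ)) :=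
    indicatorConstLp_coeFn
  have hbox : box = half + atom half (1 / 2, 0) := by
    apply Lp.ext
    filter_upwards [coeFn_box, hhalf, Lp.coeFn_add half (atom half (1 / 2, 0)),
      coeFn_atom_eq half (1 / 2, 0),
      (measurePreserving_sub_right volume (1 / 2 : ℝ)).quasiMeasurePreserving.ae_eq_comp hhalf]
      with t h1 h2 h3 h4 h5
    simp only [Function.comp_apply] at h5
    rw [h3, Pi.add_apply, h4, h1, h2, h5]
    simp only [Set.indicator, Set.mem_Ioc, zero_mul, phase_zero, one_mul]
    split_ifs <;> grind
  let S : Set ℝ := Set.Icc 0 δ ∪ Set.Icc (1 / 2 - δ) (1 / 2)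
  have hSm : MeasurableSet S := measurableSet_Icc.union measurableSet_Icc
  have hSv : volume S ≤ ENNReal.ofReal (2 * δ) := by
    refine (measure_union_le _ _).trans ?_
    rw [Real.volume_Icc, Real.volume_Icc, ← ENNReal.ofReal_add (by linarith) (by linarith)]
    apply ENNReal.ofReal_le_ofReal
    linarith
  have hSt : volume S ≠ ⊤ := (hSv.trans_lt ENNReal.ofReal_lt_top).ne
  have hdist : ‖half - f‖ ≤ ε / 2 := by
    have h1 : ‖half - f‖ ≤ ‖(indicatorConstLp 2 hSm hSt (1 : ℂ) : L2)‖ := by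
      apply Lp.norm_le_norm_of_ae_le
      filter_upwards [hhalf, hf, Lp.coeFn_sub half f,
        (indicatorConstLp_coeFn : (indicatorConstLp 2 hSm hSt (1 : ℂ) : L2) =ᵐ[volume] _)]
        with t h1 h2 h3 h4
      rw [h3, Pi.sub_apply, h1, h2, h4]
      by_cases hS : t ∈ S
      · rw [Set.indicator_of_mem hS, norm_one]
        by_cases ht : t ∈ Set.Ioc (0 : ℝ) (1 / 2)
        · rw [Set.indicator_of_mem ht]
          have : (1 : ℂ) - φ t = ((1 - β t : ℝ) : ℂ) := by simp [φ]
          rw [this, Complex.norm_real, Real.norm_eq_abs, abs_le]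
          constructor <;> linarith [β.nonneg (x := t), β.le_one (x := t)]
        · rw [Set.indicator_of_notMem ht, hzero t (fun h => ht ⟨h.1, h.2.le⟩)]
          simp
      · rw [Set.indicator_of_notMem hS, norm_zero]
        by_cases ht : t ∈ Set.Ioc (0 : ℝ) (1 / 2)
        · rw [Set.indicator_of_mem ht]
          have : β t = 1 := by
            apply β.one_of_mem_closedBall
            rw [Metric.mem_closedBall, Real.dist_eq, abs_le]
            simp only [S, Set.mem_union, Set.mem_Icc, not_or, not_and, not_le] at hS
            have h5 := hS.1 ht.1.le
            have h6 : t < 1 / 2 - δ := by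
              by_contra hcon
              exact absurd (hS.2 (not_lt.1 hcon)) (not_lt.2 ht.2)
            simp only [β]
            constructor <;> linarith
          simp [φ, this]
        · rw [Set.indicator_of_notMem ht, hzero t (fun h => ht ⟨h.1, h.2.le⟩)]
          simp
    refine h1.trans ?_
    rw [norm_indicatorConstLp (by norm_num) (by norm_num), norm_one, one_mul]
    have h2 : volume.real S ≤ (ε / 2) ^ 2 := by
      rw [Measure.real]
      refine ENNReal.toReal_le_of_le_ofReal (by positivity) (hSv.trans ?_)
      apply ENNReal.ofReal_le_ofReal
      nlinarith
    calc volume.real S ^ (1 / (2 : ℝ≥0∞).toReal) ≤ ((ε / 2) ^ 2) ^ (1 / (2 : ℝ≥0∞).toReal) := by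
          gcongr
      _ = ε / 2 := by
          rw [ENNReal.toReal_ofNat, ← Real.sqrt_eq_rpow, Real.sqrt_sq (by positivity)]
  rw [hbox]
  have : half + atom half (1 / 2, 0) - (f + atom f (1 / 2, 0))
      = (half - f) + atom (half - f) (1 / 2, 0) := by
    rw [atom_sub]; abel
  rw [this]
  refine (norm_add_le _ _).trans ?_
  rw [norm_atom]
  linarith

/-- The shifted support lies inside the single unit interval starting at ⌊x⌋. Hence the cell does
not truncate φ, and the coefficients keep the decay of its full Fourier transform. -/
theorem inner_latticeAtom_window {f : L2} {φ : ℝ → ℂ} (hf : f =ᵐ[volume] φ)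
    (hφ : ∀ t, t ∉ Set.Ioo (0 : ℝ) (1 / 2) → φ t = 0) (x ξ : ℝ) (hx : x < ⌊x⌋ + 1 / 2)
    (k : ℤ × ℤ) :
    ‖inner ℂ (latticeAtom k) (atom f (x, ξ))‖
      = if k.1 = ⌊x⌋ then ‖∫ t, phase ((ξ - k.2) * t) * φ t‖ else 0 := by
  have hfl := Int.floor_le x
  have h1 : inner ℂ (latticeAtom k) (atom f (x, ξ))
      = ∫ t in Set.Ioc (k.1 : ℝ) (k.1 + 1), phase ((ξ - k.2) * t) * φ (t - x) := by
    rw [inner_latticeAtom_left]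
    apply integral_congr_ae
    apply ae_restrict_of_ae
    filter_upwards [coeFn_atom_eq f (x, ξ),
      (measurePreserving_sub_right volume x).quasiMeasurePreserving.ae_eq_comp hf] with t h1 h2
    simp only [Function.comp_apply] at h2
    rw [h1, h2, ← mul_assoc, ← phase_add]
    congr 2; ring
  rw [h1]
  have hsupp : ∀ t, φ (t - x) ≠ 0 → (⌊x⌋ : ℝ) < t ∧ t < ⌊x⌋ + 1 := by
    intro t ht
    have : t - x ∈ Set.Ioo (0 : ℝ) (1 / 2) := by
      by_contra h
      exact ht (hφ _ h)
    constructor <;> linarith [this.1, this.2]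
  split_ifs with hk
  · rw [setIntegral_eq_integral_of_forall_compl_eq_zero]
    · have h2 : (∫ t, phase ((ξ - k.2) * t) * φ (t - x))
          = ∫ t, phase ((ξ - k.2) * (t + x)) * φ t := by
        rw [← integral_sub_right_eq_self (fun t => phase ((ξ - k.2) * (t + x)) * φ t) x]
        simp
      have h3 : ∀ t, phase ((ξ - k.2) * (t + x)) * φ t
          = phase ((ξ - k.2) * x) * (phase ((ξ - k.2) * t) * φ t) := by
        intro t
        rw [← mul_assoc, ← phase_add]; congr 2; ring
      rw [h2]
      simp_rw [h3]
      rw [integral_const_mul, norm_mul, norm_phase, one_mul]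
    · intro t ht
      by_cases h0 : φ (t - x) = 0
      · simp [h0]
      · have := hsupp t h0
        exact absurd ⟨by rw [hk]; exact this.1, by rw [hk]; exact this.2.le⟩ ht
  · rw [norm_eq_zero]
    rw [← integral_zero ℝ ℂ (μ := volume.restrict (Set.Ioc (k.1 : ℝ) (k.1 + 1)))]
    apply setIntegral_congr_fun measurableSet_Ioc
    intro t ht
    by_cases h0 : φ (t - x) = 0
    · simp [h0]
    · exfalso
      have h := hsupp t h0
      apply hk
      have a : (k.1 : ℝ) < ⌊x⌋ + 1 := by linarith [ht.1, h.2]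
      have b : (⌊x⌋ : ℝ) < k.1 + 1 := by linarith [ht.2, h.1]
      norm_cast at a b
      omega

theorem summable_one_div_one_add_sq : Summable fun j : ℤ => 1 / (1 + (j : ℝ) ^ 2) := by
  refine Summable.of_norm_bounded_eventually (g := fun j : ℤ => 1 / (j : ℝ) ^ 2)
    (Real.summable_one_div_int_pow.2 one_lt_two) ?_
  filter_upwards [(Set.finite_singleton (0 : ℤ)).compl_mem_cofinite] with j hj
  have : (0 : ℝ) < (j : ℝ) ^ 2 := by
    have : (j : ℝ) ≠ 0 := by exact_mod_cast hj
    positivity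
  rw [Real.norm_of_nonneg (by positivity)]
  gcongr
  linarith

/-- Cauchy–Schwarz for series with one factor dominated by a summable kernel. -/
theorem norm_sq_le_of_hasSum {ι : Type*} {u v : ι → ℂ} {w : ι → ℝ} {a : ℂ}
    (h : HasSum (fun i => u i * v i) a) (huw : ∀ i, ‖u i‖ ≤ w i) (hw : Summable w)
    (hwv : Summable fun i => w i * ‖v i‖ ^ 2) :
    ‖a‖ ^ 2 ≤ (∑' i, w i) * ∑' i, w i * ‖v i‖ ^ 2 := by
  have hw0 : ∀ i, 0 ≤ w i := fun i => (norm_nonneg _).trans (huw i)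
  refine le_of_tendsto (h.norm.pow 2) (Eventually.of_forall fun s => ?_)
  calc ‖∑ i ∈ s, u i * v i‖ ^ 2 ≤ (∑ i ∈ s, w i * ‖v i‖) ^ 2 := by
        gcongr
        refine (norm_sum_le _ _).trans (Finset.sum_le_sum fun i _ => ?_)
        rw [norm_mul]
        exact mul_le_mul_of_nonneg_right (huw i) (norm_nonneg _)
    _ ≤ (∑ i ∈ s, w i) * ∑ i ∈ s, w i * ‖v i‖ ^ 2 := by
        refine Finset.sum_sq_le_sum_mul_sum_of_sq_le_mul s (fun i _ => hw0 i)
          (fun i _ => mul_nonneg (hw0 i) (by positivity)) (fun i _ => le_of_eq (by ring))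
    _ ≤ _ := by
        gcongr
        · exact Finset.sum_nonneg fun i _ => mul_nonneg (hw0 i) (by positivity)
        · exact tsum_nonneg hw0
        · exact hw.sum_le_tsum s (fun i _ => hw0 i)
        · exact hwv.sum_le_tsum s (fun i _ => mul_nonneg (hw0 i) (by positivity))

/-! ### Amalgam bounds and uniformly small tails -/

/-- Expanding in the lattice basis leaves only the row ⌊x⌋, with coefficients dominated by a
summable kernel. Weighted Cauchy–Schwarz then bounds the square by a convolution of that kernel with
the squared lattice coefficients of g, which is summable. -/
theorem IsSmoothWindow.exists_cell_bound_left {f : L2} (hf : IsSmoothWindow f) (g : L2) :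
    ∃ b : ℤ × ℤ → ℝ, Summable b ∧ (∀ k, 0 ≤ b k) ∧ ∀ x ξ : ℝ, x < ⌊x⌋ + 1 / 2 →
      ‖inner ℂ (atom f (x, ξ)) g‖ ^ 2 ≤ b (⌊x⌋, ⌊ξ⌋) := by
  obtain ⟨φ, hfφ, hφ, C, hC, hdecay⟩ := hf
  -- The factor 3 pays for replacing ξ by ⌊ξ⌋ in the quadratic decay.
  let κ : ℤ → ℝ := fun j => 3 * C * (1 / (1 + (j : ℝ) ^ 2))
  have hκ : Summable κ := summable_one_div_one_add_sq.mul_left _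
  have hκ0 : ∀ j, 0 ≤ κ j := fun j => by positivity
  let α : ℤ × ℤ → ℝ := fun k => ‖inner ℂ (latticeAtom k) g‖ ^ 2
  have hα : Summable α := orthonormal_latticeAtom.inner_products_summable g
  have hα0 : ∀ k, 0 ≤ α k := fun k => by positivity
  let e : (ℤ × ℤ) × ℤ ≃ (ℤ × ℤ) × ℤ :=
    { toFun := fun q => ((q.1.1, q.2), q.2 - q.1.2)
      invFun := fun q => ((q.1.1, q.1.2 - q.2), q.1.2)
      left_inv := fun q => by simp
      right_inv := fun q => by simp }
  have hF : Summable fun q : (ℤ × ℤ) × ℤ => κ (q.2 - q.1.2) * α (q.1.1, q.2) := by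
    have := (e.summable_iff).2 (hα.mul_of_nonneg hκ hα0 hκ0)
    refine this.congr fun q => ?_
    simp [e, mul_comm]
  refine ⟨fun k => (∑' j, κ j) * ∑' n, κ (n - k.2) * α (k.1, n), hF.prod.mul_left _, fun k => ?_,
    fun x ξ hx => ?_⟩
  · exact mul_nonneg (tsum_nonneg hκ0) (tsum_nonneg fun n => mul_nonneg (hκ0 _) (hα0 _))
  · have hs := latticeBasis.hasSum_inner_mul_inner (atom f (x, ξ)) g
    simp only [latticeBasis_apply] at hs
    have hcoef := inner_latticeAtom_window hfφ hφ x ξ hx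
    have hinj : Function.Injective fun n : ℤ => (⌊x⌋, n) := fun a b h => by simpa using h
    rw [← hinj.hasSum_iff] at hs
    swap
    · rintro ⟨m, n⟩ hmn
      have : m ≠ ⌊x⌋ := fun h => hmn ⟨n, by rw [h]⟩
      have h0 := hcoef (m, n)
      rw [if_neg this, norm_inner_symm, norm_eq_zero] at h0
      rw [h0, zero_mul]
    have hshift : Summable fun n : ℤ => κ (n - ⌊ξ⌋) := (Equiv.subRight ⌊ξ⌋).summable_iff.2 hκ
    have hle := norm_sq_le_of_hasSum (w := fun n : ℤ => κ (n - ⌊ξ⌋)) hs ?_ hshift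
      (hF.prod_factor (⌊x⌋, ⌊ξ⌋))
    · have hκs : ∑' n, κ (n - ⌊ξ⌋) = ∑' j, κ j := (Equiv.subRight ⌊ξ⌋).tsum_eq κ
      rwa [hκs] at hle
    · intro n
      rw [norm_inner_symm, hcoef, if_pos rfl]
      refine (hdecay _).trans ?_
      simp only [κ]
      rw [mul_one_div, div_le_div_iff₀ (by positivity) (by positivity)]
      have h1 := Int.floor_le ξ
      have h2 := Int.lt_floor_add_one ξ
      push_cast
      have h3 : 1 + ((n : ℝ) - ⌊ξ⌋) ^ 2 ≤ 3 * (1 + (ξ - n) ^ 2) := by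
        nlinarith [sq_nonneg ((ξ - n) + (ξ - ⌊ξ⌋) ), sq_nonneg ((ξ - n) - (ξ - ⌊ξ⌋)),
          sq_nonneg (ξ - n)]
      calc C * (1 + ((n : ℝ) - ⌊ξ⌋) ^ 2) ≤ C * (3 * (1 + (ξ - n) ^ 2)) := by gcongr
        _ = _ := by ring

theorem IsSmoothWindow.exists_cell_bound {f : L2} (hf : IsSmoothWindow f) (g : L2) :
    ∃ b : ℤ × ℤ → ℝ, Summable b ∧ (∀ k, 0 ≤ b k) ∧ ∀ x ξ : ℝ,
      ‖inner ℂ (atom f (x, ξ)) g‖ ^ 2 ≤ b (⌊x⌋, ⌊ξ⌋) := by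
  obtain ⟨b₁, hs₁, hn₁, h₁⟩ := hf.exists_cell_bound_left g
  obtain ⟨b₂, hs₂, hn₂, h₂⟩ := hf.exists_cell_bound_left (atom g (-(1 / 2), 0))
  refine ⟨fun k => b₁ k + b₂ k, hs₁.add hs₂, fun k => add_nonneg (hn₁ k) (hn₂ k), fun x ξ => ?_⟩
  by_cases hx : x < ⌊x⌋ + 1 / 2
  · linarith [h₁ x ξ hx, hn₂ (⌊x⌋, ⌊ξ⌋)]
  -- In the right half of a cell, moving both x and g back by 1/2 keeps the cell and reduces to the
  -- left half.
  · have hfl : ⌊x - 1 / 2⌋ = ⌊x⌋ := by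
      rw [Int.floor_eq_iff]
      constructor <;> linarith [Int.lt_floor_add_one x]
    have := h₂ (x - 1 / 2) ξ (by rw [hfl]; linarith [Int.lt_floor_add_one x])
    rw [hfl, norm_inner_atom_atom] at this
    have heq : ((x - 1 / 2, ξ) - (-(1 / 2), 0) : ℝ × ℝ) = (x, ξ) := by
      ext <;> simp
    rw [heq] at this
    linarith [hn₁ (⌊x⌋, ⌊ξ⌋)]

/-- Two points in one cell of side 1/M are less than 2/M < δ apart, so each cell holds at most one
point of Λ. -/
theorem UniformlyDiscrete.exists_mesh {Λ : Set (ℝ × ℝ)} (hΛ : UniformlyDiscrete Λ) :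
    ∃ M : ℕ, 0 < M ∧ ∀ p ∈ Λ, ∀ q ∈ Λ, M * |p.1 - q.1| < 1 → M * |p.2 - q.2| < 1 → p = q := by
  obtain ⟨δ, hδ, h⟩ := hΛ
  obtain ⟨M, hM⟩ := exists_nat_gt (2 / δ)
  have hM0 : (0 : ℝ) < M := lt_trans (by positivity) hM
  refine ⟨M, by exact_mod_cast hM0, fun p hp q hq h1 h2 => ?_⟩
  by_contra hne
  have h3 := h p hp q hq hne
  rw [div_lt_iff₀ hδ] at hM
  have h4 : Real.sqrt ((p.1 - q.1) ^ 2 + (p.2 - q.2) ^ 2) ≤ |p.1 - q.1| + |p.2 - q.2| := by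
    apply Real.sqrt_le_iff.2
    refine ⟨by positivity, ?_⟩
    nlinarith [sq_abs (p.1 - q.1), sq_abs (p.2 - q.2),
      mul_nonneg (abs_nonneg (p.1 - q.1)) (abs_nonneg (p.2 - q.2))]
  nlinarith

/-- The index of the square cell of side length `1 / M` that contains a point. -/
def cell (M : ℕ) (p : ℝ × ℝ) : ℤ × ℤ := (⌊M * p.1⌋, ⌊M * p.2⌋)

theorem abs_sub_lt_of_cell_eq {M : ℕ} {p q : ℝ × ℝ} (h : cell M p = cell M q) :
    M * |p.1 - q.1| < 1 ∧ M * |p.2 - q.2| < 1 := by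
  simp only [cell, Prod.mk.injEq] at h
  have a := Int.abs_sub_lt_one_of_floor_eq_floor h.1
  have b := Int.abs_sub_lt_one_of_floor_eq_floor h.2
  rw [← mul_sub, abs_mul, Nat.abs_cast] at a b
  exact ⟨a, b⟩

theorem floor_eq_floor_mul_ediv {M : ℕ} (hM : 0 < M) (x : ℝ) : ⌊x⌋ = ⌊M * x⌋ / (M : ℤ) := by
  refine eq_of_forall_le_iff fun j => ?_
  have hM' : (0 : ℝ) < M := by exact_mod_cast hM
  rw [Int.le_ediv_iff_mul_le (by exact_mod_cast hM), Int.le_floor, Int.le_floor]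
  push_cast
  rw [mul_comm (j : ℝ), mul_le_mul_iff_right₀ hM']

/-- Each unit cell splits into M² fine cells, so the series repeats every term M² times. -/
theorem summable_comp_ediv {b : ℤ × ℤ → ℝ} (hb : Summable b) (hb0 : ∀ k, 0 ≤ b k) {M : ℕ}
    (hM : 0 < M) : Summable fun k : ℤ × ℤ => b (k.1 / (M : ℤ), k.2 / (M : ℤ)) := by
  have : NeZero M := ⟨hM.ne'⟩
  let e : ℤ × ℤ ≃ (ℤ × ℤ) × (Fin M × Fin M) :=
    ((Int.divModEquiv M).prodCongr (Int.divModEquiv M)).trans (Equiv.prodProdProdComm _ _ _ _)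
  have h1 : Summable fun q : (ℤ × ℤ) × (Fin M × Fin M) => b q.1 * 1 :=
    hb.mul_of_nonneg (f := b) (g := fun _ : Fin M × Fin M => (1 : ℝ))
      (Summable.of_finite) hb0 (fun _ => zero_le_one)
  refine (e.summable_iff.2 h1).congr fun k => ?_
  simp [e, Int.divModEquiv]

/-- Distinct p give distinct fine cells of z - p, so the sum is at most a tail of one fixed summable
series over cells. That series does not depend on z, hence neither does R. -/
theorem IsSmoothWindow.tail_small {f : L2} (hf : IsSmoothWindow f) (g : L2) {Λ : Set (ℝ × ℝ)}
    (hΛ : UniformlyDiscrete Λ) {ε : ℝ} (hε : 0 < ε) :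
    ∃ R : ℝ, 0 < R ∧ ∀ z : ℝ × ℝ, ∀ t : Finset (ℝ × ℝ), (∀ p ∈ t, p ∈ Λ ∧ p ∉ square z R) →
      ∑ p ∈ t, ‖inner ℂ (atom f z) (atom g p)‖ ^ 2 ≤ ε := by
  obtain ⟨b, hb, hb0, hbound⟩ := hf.exists_cell_bound g
  obtain ⟨M, hM, hsep⟩ := hΛ.exists_mesh
  have hs := summable_comp_ediv hb hb0 hM
  obtain ⟨s, hs⟩ := summable_iff_vanishing_norm.1 hs ε hε
  obtain ⟨N, hN⟩ : ∃ N : ℤ, ∀ k ∈ s, |k.1| ≤ N ∧ |k.2| ≤ N := by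
    refine ⟨∑ k ∈ s, (|k.1| + |k.2|), fun k hk => ?_⟩
    have := Finset.single_le_sum (f := fun k : ℤ × ℤ => |k.1| + |k.2|)
      (fun i _ => by positivity) hk

    constructor <;> linarith [abs_nonneg k.1, abs_nonneg k.2]
  have hM1 : (1 : ℝ) ≤ M := by exact_mod_cast hM
  refine ⟨|(N : ℝ)| + 1, by positivity, fun z t ht => ?_⟩
  have hfloor : ∀ u : ℝ, |⌊M * u⌋| ≤ N → |u| ≤ |(N : ℝ)| + 1 := by
    intro u hu
    have h1 : |((⌊M * u⌋ : ℤ) : ℝ)| ≤ |(N : ℝ)| := by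
      have : |((⌊M * u⌋ : ℤ) : ℝ)| ≤ (N : ℝ) := by exact_mod_cast hu
      exact this.trans (le_abs_self _)
    rw [abs_le] at h1
    have h2 := Int.floor_le ((M : ℝ) * u)
    have h3 := Int.lt_floor_add_one ((M : ℝ) * u)
    have h4 : |(M : ℝ) * u| ≤ |(N : ℝ)| + 1 := abs_le.2 ⟨by linarith [h1.1], by linarith [h1.2]⟩
    rw [abs_mul, Nat.abs_cast] at h4
    nlinarith [abs_nonneg u]
  have hinj : Set.InjOn (fun p => cell M (z - p)) t := by
    intro p hp q hq hpq
    obtain ⟨h1, h2⟩ := abs_sub_lt_of_cell_eq hpq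
    refine hsep p (ht p hp).1 q (ht q hq).1 ?_ ?_
    · rwa [abs_sub_comm, show q.1 - p.1 = (z - p).1 - (z - q).1 by simp]
    · rwa [abs_sub_comm, show q.2 - p.2 = (z - p).2 - (z - q).2 by simp]
  have hdisj : Disjoint (t.image fun p => cell M (z - p)) s := by
    rw [Finset.disjoint_left]
    intro k hk hks
    obtain ⟨p, hp, rfl⟩ := Finset.mem_image.1 hk
    apply (ht p hp).2
    obtain ⟨h1, h2⟩ := hN _ hks
    have h1 := hfloor _ h1
    have h2 := hfloor _ h2
    constructor
    · rwa [abs_sub_comm]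
    · rwa [abs_sub_comm]
  have hlt := (le_abs_self _).trans (hs _ hdisj).le
  rw [Finset.sum_image hinj] at hlt
  refine le_trans (Finset.sum_le_sum fun p _ => ?_) hlt
  rw [norm_inner_atom_atom]
  refine (hbound (z - p).1 (z - p).2).trans (le_of_eq ?_)
  rw [floor_eq_floor_mul_ediv hM (z - p).1, floor_eq_floor_mul_ediv hM (z - p).2]
  rfl

theorem UniformlyDiscrete.exists_count_bound {Λ : Set (ℝ × ℝ)} (hΛ : UniformlyDiscrete Λ) :
    ∃ M : ℕ, ∀ (c : ℝ × ℝ) (R : ℝ), 0 ≤ R → (Λ ∩ square c R).Finite ∧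
      ((Λ ∩ square c R).ncard : ℝ) ≤ (2 * M * R + 2) ^ 2 := by
  obtain ⟨M, hM, hsep⟩ := hΛ.exists_mesh
  refine ⟨M, fun c R hR => ?_⟩
  let I : ℝ → Finset ℤ := fun x => Finset.Icc ⌊M * (x - R)⌋ ⌊M * (x + R)⌋
  have hI : ∀ x, ((I x).card : ℝ) ≤ 2 * M * R + 2 := by
    intro x
    have h1 : ⌊(M : ℝ) * (x - R)⌋ ≤ ⌊(M : ℝ) * (x + R)⌋ + 1 := by
      have : (M : ℝ) * (x - R) ≤ M * (x + R) := by gcongr; linarith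
      linarith [Int.floor_le_floor this]
    have h2 : ((I x).card : ℤ) = ⌊(M : ℝ) * (x + R)⌋ + 1 - ⌊(M : ℝ) * (x - R)⌋ := by
      rw [Int.card_Icc, Int.toNat_of_nonneg (by linarith)]
    have h3 : ((I x).card : ℝ) = (⌊(M : ℝ) * (x + R)⌋ + 1 - ⌊(M : ℝ) * (x - R)⌋ : ℝ) := by
      exact_mod_cast h2
    rw [h3]
    linarith [Int.floor_le ((M : ℝ) * (x + R)), Int.lt_floor_add_one ((M : ℝ) * (x - R))]
  have hinj : Set.InjOn (cell M) (Λ ∩ square c R) := by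
    intro p hp q hq hpq
    obtain ⟨h1, h2⟩ := abs_sub_lt_of_cell_eq hpq
    exact hsep p hp.1 q hq.1 h1 h2
  have hmaps : Set.MapsTo (cell M) (Λ ∩ square c R) (I c.1 ×ˢ I c.2 : Finset (ℤ × ℤ)) := by
    rintro p ⟨-, h1, h2⟩
    rw [abs_le] at h1 h2
    simp only [Finset.coe_product, I, Finset.coe_Icc, cell]
    refine ⟨⟨?_, ?_⟩, ⟨?_, ?_⟩⟩ <;> apply Int.floor_le_floor <;> gcongr <;> linarith
  refine ⟨Set.Finite.of_injOn hmaps hinj (Finset.finite_toSet _), ?_⟩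
  have h1 := Set.ncard_le_ncard_of_injOn _ hmaps hinj (Finset.finite_toSet _)
  rw [Set.ncard_coe_finset, Finset.card_product] at h1
  calc ((Λ ∩ square c R).ncard : ℝ) ≤ (I c.1).card * (I c.2).card := by exact_mod_cast h1
    _ ≤ (2 * M * R + 2) * (2 * M * R + 2) := by
        gcongr
        · exact hI _
        · exact hI _
    _ = _ := by ring

/-! ### Dimension comparison and duality in Hilbert space -/

section Hilbert

variable {ι : Type*} {H : Type*} [NormedAddCommGroup H] [InnerProductSpace ℂ H]

/-- A finite family with a bounded biorthogonal system that is close to a subspace has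
essentially at most as many members as the dimension of the subspace. -/
theorem card_le_finrank_of_biorthogonal [Fintype ι] [DecidableEq ι] {f v : ι → H}
    (hv : ∀ i j, inner ℂ (v i) (f j) = if i = j then (1 : ℂ) else 0) {C ε : ℝ}
    (hC : ∀ i, ‖v i‖ ≤ C) (W : Submodule ℂ H) [FiniteDimensional ℂ W]
    (hW : ∀ i, ‖f i - W.starProjection (f i)‖ ≤ ε) :
    (1 - C * ε) * Fintype.card ι ≤ Module.finrank ℂ W := by
  let V : Submodule ℂ H := Submodule.span ℂ (Set.range f)
  have : FiniteDimensional ℂ V := FiniteDimensional.span_of_finite ℂ (Set.finite_range f)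
  -- Projecting onto V keeps biorthogonality, does not increase norms, and turns the pair w, f into
  -- an expansion of the projection onto V.
  let w : ι → H := fun i => V.starProjection (v i)
  have hfV : ∀ j, V.starProjection (f j) = f j := fun j =>
    Submodule.starProjection_eq_self_iff.2 (Submodule.subset_span ⟨j, rfl⟩)
  have hw : ∀ i j, inner ℂ (w i) (f j) = if i = j then (1 : ℂ) else 0 := by
    intro i j
    rw [Submodule.inner_starProjection_left_eq_right, hfV, hv]
  have hproj : ∀ x, V.starProjection x = ∑ j, (inner ℂ (w j) x : ℂ) • f j := by
    intro x
    have hx : V.starProjection x ∈ V := Submodule.starProjection_apply_mem _ _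
    obtain ⟨c, hc⟩ := (Submodule.mem_span_range_iff_exists_fun ℂ).1 hx
    rw [← hc]
    refine Finset.sum_congr rfl fun i _ => ?_
    congr 1
    rw [Submodule.inner_starProjection_left_eq_right, ← hc, inner_sum]
    simp [inner_smul_right, hv]
  let u := stdOrthonormalBasis ℂ W
  have hW' : ∀ x, W.starProjection x = ∑ k, (inner ℂ (u k : H) x : ℂ) • (u k : H) := by
    intro x
    have := u.orthogonalProjectionOnto_apply_eq_sum x
    rw [Submodule.starProjection_apply, this]
    simp
  -- Both sides are the trace of the product of the projections onto V and W.
  have htrace : ∑ j, (inner ℂ (w j) (W.starProjection (f j)) : ℂ)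
      = ∑ k, (inner ℂ (u k : H) (V.starProjection (u k : H)) : ℂ) := by
    simp_rw [hW', hproj, inner_sum, inner_smul_right]
    rw [Finset.sum_comm]
    refine Finset.sum_congr rfl fun k _ => Finset.sum_congr rfl fun j _ => mul_comm _ _
  have hlow : ∀ j, 1 - C * ε ≤ (inner ℂ (w j) (W.starProjection (f j)) : ℂ).re := by
    intro j
    have h1 : (inner ℂ (w j) (W.starProjection (f j)) : ℂ)
        = 1 - inner ℂ (w j) (f j - W.starProjection (f j)) := by
      rw [inner_sub_right, hw]; simp
    rw [h1, Complex.sub_re, Complex.one_re]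
    have h2 : ‖(inner ℂ (w j) (f j - W.starProjection (f j)) : ℂ)‖ ≤ C * ε := by
      refine (norm_inner_le_norm _ _).trans ?_
      have hwC : ‖w j‖ ≤ C := (Submodule.norm_starProjection_apply_le V (v j)).trans (hC j)
      exact mul_le_mul hwC (hW j) (norm_nonneg _) ((norm_nonneg _).trans hwC)
    linarith [(Complex.re_le_norm (inner ℂ (w j) (f j - W.starProjection (f j)) : ℂ))]
  have hup : ∀ k, (inner ℂ (u k : H) (V.starProjection (u k : H)) : ℂ).re ≤ 1 := by
    intro k
    have hk : ‖(u k : H)‖ = 1 := u.orthonormal.1 k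
    refine (Complex.re_le_norm _).trans ((norm_inner_le_norm _ _).trans ?_)
    have := Submodule.norm_starProjection_apply_le V (u k : H)
    rw [hk] at this ⊢
    linarith
  calc (1 - C * ε) * Fintype.card ι = ∑ _j : ι, (1 - C * ε) := by
        rw [Finset.sum_const, Finset.card_univ, nsmul_eq_mul, mul_comm]
    _ ≤ ∑ j, (inner ℂ (w j) (W.starProjection (f j)) : ℂ).re :=
        Finset.sum_le_sum fun j _ => hlow j
    _ = ∑ k, (inner ℂ (u k : H) (V.starProjection (u k : H)) : ℂ).re := by
        rw [← Complex.re_sum, htrace, Complex.re_sum]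
    _ ≤ ∑ _k : Fin (Module.finrank ℂ W), (1 : ℝ) := Finset.sum_le_sum fun k _ => hup k
    _ = _ := by simp

/-- The dual vectors are the images of the orthonormal basis under the adjoint of the inverse of T,
hence bounded by its norm. -/
theorem IsRieszSequence.exists_biorthogonal [CompleteSpace H] [DecidableEq ι] {f : ι → H}
    (hf : IsRieszSequence f) : ∃ (v : ι → H) (C : ℝ), 0 ≤ C ∧ (∀ i, ‖v i‖ ≤ C) ∧
      ∀ i j, inner ℂ (v i) (f j) = if i = j then (1 : ℂ) else 0 := by
  obtain ⟨e, T, hT⟩ := hf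
  have : CompleteSpace (closedSpan f) :=
    (Submodule.isClosed_topologicalClosure _).completeSpace_coe
  let A : closedSpan f →L[ℂ] closedSpan f :=
    ContinuousLinearMap.adjoint (T.symm : closedSpan f →L[ℂ] closedSpan f)
  refine ⟨fun i => (A (e i) : closedSpan f), ‖A‖, A.opNorm_nonneg, fun i => ?_, fun i j => ?_⟩
  · have := A.le_opNorm (e i)
    rw [e.orthonormal.1 i, mul_one] at this
    simpa using this
  · have h1 : f j = ((⟨f j, mem_closedSpan f j⟩ : closedSpan f) : H) := rfl
    have hTj : (⟨f j, mem_closedSpan f j⟩ : closedSpan f) = T (e j) := hT j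
    rw [h1, ← Submodule.coe_inner, hTj, ContinuousLinearMap.adjoint_inner_left]
    simp only [ContinuousLinearEquiv.coe_coe, ContinuousLinearEquiv.symm_apply_apply]
    exact orthonormal_iff_ite.1 e.orthonormal i j

/-- Localized reconstruction from a frame: a vector is close to any subspace that contains the
canonical dual frame vectors of all indices at which its frame coefficients are not small. -/
theorem IsFrame.exists_dual [CompleteSpace H] {f : ι → H} (hf : IsFrame f) :
    ∃ (h : ι → H) (K : ℝ), 0 < K ∧ ∀ (x : H) (W : Submodule ℂ H) [FiniteDimensional ℂ W] (T : ℝ),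
      0 ≤ T → (∀ t : Finset ι, (∀ i ∈ t, h i ∉ W) → ∑ i ∈ t, ‖inner ℂ x (f i)‖ ^ 2 ≤ T ^ 2) →
      ‖x - W.starProjection x‖ ≤ K * T := by
  classical
  obtain ⟨A, B, hA, hB, hf⟩ := hf
  have hmem : ∀ x : H, Memℓp (fun i => (inner ℂ (f i) x : ℂ)) 2 := by
    intro x
    refine memℓp_gen ?_
    have := (hf x).1
    simp_rw [norm_inner_symm x] at this
    simpa using this
  let C₀ : H →ₗ[ℂ] lp (fun _ : ι => ℂ) 2 :=
    { toFun := fun x => ⟨fun i => inner ℂ (f i) x, hmem x⟩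
      map_add' := fun x y => by ext i; exact inner_add_right _ _ _
      map_smul' := fun c x => by ext i; exact inner_smul_right _ _ _ }
  have hC₀ : ∀ x y, HasSum (fun i => (inner ℂ x (f i) * inner ℂ (f i) y : ℂ))
      (inner ℂ (C₀ x) (C₀ y)) := by
    intro x y
    convert! lp.hasSum_inner (𝕜 := ℂ) (C₀ x) (C₀ y) using 2 with i
    rw [RCLike.inner_apply, ← inner_conj_symm x, mul_comm]
    rfl
  have hself : ∀ x, (inner ℂ (C₀ x) (C₀ x) : ℂ) = ((∑' i, ‖inner ℂ x (f i)‖ ^ 2 : ℝ) : ℂ) := by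
    intro x
    refine (hC₀ x x).unique ?_
    convert Complex.hasSum_ofReal.2 (hf x).1.hasSum using 2 with i
    rw [← inner_conj_symm (f i) x, Complex.mul_conj, Complex.normSq_eq_norm_sq]
  have hbound : ∀ x, ‖C₀ x‖ ≤ Real.sqrt B * ‖x‖ := by
    intro x
    refine abs_le_of_sq_le_sq' ?_ (by positivity) |>.2
    have h1 : ((‖C₀ x‖ ^ 2 : ℝ) : ℂ) = ((∑' i, ‖inner ℂ x (f i)‖ ^ 2 : ℝ) : ℂ) := by
      rw [← hself, inner_self_eq_norm_sq_to_K]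
      norm_cast
    rw [Complex.ofReal_inj.1 h1, mul_pow, Real.sq_sqrt hB.le]
    exact (hf x).2.2
  let C : H →L[ℂ] lp (fun _ : ι => ℂ) 2 := C₀.mkContinuous (Real.sqrt B) hbound
  let S : H →L[ℂ] H := (ContinuousLinearMap.adjoint C).comp C
  have hS : ∀ x y, (inner ℂ (S x) y : ℂ) = inner ℂ (C₀ x) (C₀ y) := by
    intro x y
    simp only [S, ContinuousLinearMap.comp_apply, ContinuousLinearMap.adjoint_inner_left]
    rfl
  have hS' : ∀ x y, (inner ℂ (S x) y : ℂ) = inner ℂ x (S y) := by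
    intro x y
    rw [hS, ← inner_conj_symm x, hS, inner_conj_symm]
  have hlow : ∀ x, A * ‖x‖ ^ 2 ≤ ‖(inner ℂ (S x) x : ℂ)‖ := by
    intro x
    rw [hS, hself, Complex.norm_real]
    exact (hf x).2.1.trans (le_abs_self _)
  -- The lower frame bound makes the frame operator S coercive, hence invertible.
  obtain ⟨U, hU⟩ := S.isUnit_of_forall_le_norm_inner_map (c := ⟨A, hA.le⟩) hA
    (fun x => by rw [mul_comm]; exact hlow x)
  let Sinv : H →L[ℂ] H := ↑U⁻¹
  have hSS : ∀ x, S (Sinv x) = x := by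
    intro x
    have : S * Sinv = 1 := by rw [← hU]; exact U.mul_inv
    exact congrArg (fun L : H →L[ℂ] H => L x) this
  refine ⟨fun i => Sinv (f i), Real.sqrt B / A, by positivity, fun x W _ T hT hx => ?_⟩
  set y := x - W.starProjection x with hy
  set u := Sinv y with hu
  have hperp : ∀ w ∈ W, (inner ℂ w y : ℂ) = 0 := fun w hw =>
    (Submodule.mem_orthogonal _ _).1 (Submodule.sub_starProjection_mem_orthogonal x) w hw
  -- By self-adjointness of S, the coefficient of u at f i is the inner product of y with a dual
  -- vector in W, and y is orthogonal to W.
  have hvanish : ∀ i, Sinv (f i) ∈ W → (inner ℂ u (f i) : ℂ) = 0 := by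
    intro i hi
    rw [← inner_conj_symm, ← hSS (f i), hS', hSS, hperp _ hi, map_zero]
  have hyx : (inner ℂ y x : ℂ) = (‖y‖ ^ 2 : ℝ) := by
    have h1 : x = y + W.starProjection x := by rw [hy]; abel
    have h2 : (inner ℂ y (W.starProjection x) : ℂ) = 0 := by
      rw [← inner_conj_symm, hperp _ (Submodule.starProjection_apply_mem _ _), map_zero]
    conv_lhs => rw [h1]
    rw [inner_add_right, h2, add_zero, inner_self_eq_norm_sq_to_K]
    norm_cast
  have hu_norm : A * ‖u‖ ≤ ‖y‖ := by
    have h1 := hlow u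
    rw [hSS] at h1
    have h2 := h1.trans (norm_inner_le_norm y u)
    by_cases h0 : ‖u‖ = 0
    · rw [h0]; simp
    · have : 0 < ‖u‖ := lt_of_le_of_ne (norm_nonneg _) (Ne.symm h0)
      nlinarith
  have hsum : HasSum (fun i => (inner ℂ u (f i) * inner ℂ (f i) x : ℂ)) (inner ℂ y x) := by
    have := hC₀ u x
    rwa [← hS, hSS] at this
  -- The left side is ‖y‖². Only indices with dual vector outside W contribute; Cauchy–Schwarz uses
  -- the upper frame bound for u and the hypothesis on T for x.
  have hle : ‖(inner ℂ y x : ℂ)‖ ≤ Real.sqrt B * ‖u‖ * T := by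
    refine le_of_tendsto hsum.norm (Eventually.of_forall fun t => ?_)
    let t' := t.filter fun i => Sinv (f i) ∉ W
    have h1 : ∑ i ∈ t, (inner ℂ u (f i) * inner ℂ (f i) x : ℂ)
        = ∑ i ∈ t', (inner ℂ u (f i) * inner ℂ (f i) x : ℂ) := by
      rw [Finset.sum_filter]
      refine Finset.sum_congr rfl fun i _ => ?_
      by_cases h : Sinv (f i) ∈ W
      · rw [if_neg (not_not.2 h), hvanish i h, zero_mul]
      · rw [if_pos h]
    rw [h1]
    have h2 : ‖∑ i ∈ t', (inner ℂ u (f i) * inner ℂ (f i) x : ℂ)‖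
        ≤ ∑ i ∈ t', ‖(inner ℂ u (f i) : ℂ)‖ * ‖(inner ℂ x (f i) : ℂ)‖ := by
      refine (norm_sum_le _ _).trans (le_of_eq (Finset.sum_congr rfl fun i _ => ?_))
      rw [norm_mul, norm_inner_symm (f i) x]
    refine h2.trans (abs_le_of_sq_le_sq' ?_ (by positivity)).2
    refine (Finset.sum_mul_sq_le_sq_mul_sq _ _ _).trans ?_
    have h3 : ∑ i ∈ t', ‖(inner ℂ u (f i) : ℂ)‖ ^ 2 ≤ B * ‖u‖ ^ 2 :=
      ((hf u).1.sum_le_tsum t' fun _ _ => by positivity).trans (hf u).2.2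
    have h4 := hx t' fun i hi => (Finset.mem_filter.1 hi).2
    calc _ ≤ (B * ‖u‖ ^ 2) * T ^ 2 := by gcongr
      _ = _ := by rw [mul_pow, mul_pow, Real.sq_sqrt hB.le]
  rw [hyx, Complex.norm_real, Real.norm_of_nonneg (by positivity)] at hle
  by_cases h0 : ‖y‖ = 0
  · rw [h0]; positivity
  · have hpos : 0 < ‖y‖ := lt_of_le_of_ne (norm_nonneg _) (Ne.symm h0)
    have h5 : ‖u‖ ≤ ‖y‖ / A := by rw [le_div_iff₀ hA]; linarith
    have h6 : ‖y‖ ^ 2 ≤ Real.sqrt B * (‖y‖ / A) * T := hle.trans (by gcongr)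
    have h7 : ‖y‖ * ‖y‖ ≤ ‖y‖ * (Real.sqrt B / A * T) := by
      calc ‖y‖ * ‖y‖ = ‖y‖ ^ 2 := by ring
        _ ≤ _ := h6
        _ = _ := by ring
    exact le_of_mul_le_mul_left h7 hpos

end Hilbert

/-! ### Lattice points and comparison for frames -/

/-- The integer lattice points in a square. -/
def latticePoints (c : ℝ × ℝ) (R : ℝ) : Finset (ℤ × ℤ) :=
  Finset.Icc ⌈c.1 - R⌉ ⌊c.1 + R⌋ ×ˢ Finset.Icc ⌈c.2 - R⌉ ⌊c.2 + R⌋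

theorem mem_latticePoints {c : ℝ × ℝ} {R : ℝ} {k : ℤ × ℤ} :
    k ∈ latticePoints c R ↔ ((k.1 : ℝ), (k.2 : ℝ)) ∈ square c R := by
  simp only [latticePoints, Finset.mem_product, Finset.mem_Icc, Int.ceil_le, Int.le_floor, square,
    Set.mem_ofPred_eq, abs_le]
  constructor <;> rintro ⟨⟨a, b⟩, ⟨c, d⟩⟩ <;> refine ⟨⟨?_, ?_⟩, ⟨?_, ?_⟩⟩ <;> linarith

theorem card_Icc_ceil_floor (x : ℝ) {R : ℝ} (hR : 0 ≤ R) :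
    2 * R - 1 ≤ ((Finset.Icc ⌈x - R⌉ ⌊x + R⌋).card : ℝ) ∧
      ((Finset.Icc ⌈x - R⌉ ⌊x + R⌋).card : ℝ) ≤ 2 * R + 1 := by
  have h1 := Int.floor_le (x + R)
  have h2 := Int.lt_floor_add_one (x + R)
  have h3 := Int.le_ceil (x - R)
  have h4 := Int.ceil_lt_add_one (x - R)
  have h5 : ⌈x - R⌉ ≤ ⌊x + R⌋ + 1 := by
    have : (⌈x - R⌉ : ℝ) < ⌊x + R⌋ + 1 + 1 := by linarith
    have : ⌈x - R⌉ < ⌊x + R⌋ + 1 + 1 := by exact_mod_cast this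
    omega
  have h6 : ((Finset.Icc ⌈x - R⌉ ⌊x + R⌋).card : ℝ) = (⌊x + R⌋ + 1 - ⌈x - R⌉ : ℝ) := by
    have : ((Finset.Icc ⌈x - R⌉ ⌊x + R⌋).card : ℤ) = ⌊x + R⌋ + 1 - ⌈x - R⌉ := by
      rw [Int.card_Icc, Int.toNat_of_nonneg (by linarith)]
    exact_mod_cast this
  rw [h6]
  constructor <;> linarith

theorem card_latticePoints_le (c : ℝ × ℝ) {R : ℝ} (hR : 0 ≤ R) :
    ((latticePoints c R).card : ℝ) ≤ (2 * R + 1) ^ 2 := by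
  rw [latticePoints, Finset.card_product, Nat.cast_mul, sq]
  exact mul_le_mul (card_Icc_ceil_floor _ hR).2 (card_Icc_ceil_floor _ hR).2 (by positivity)
    (by positivity)

theorem le_card_latticePoints (c : ℝ × ℝ) {R : ℝ} (hR : 1 ≤ R) :
    (2 * R - 1) ^ 2 ≤ ((latticePoints c R).card : ℝ) := by
  rw [latticePoints, Finset.card_product, Nat.cast_mul, sq]
  have hR' : 0 ≤ R := by linarith
  exact mul_le_mul (card_Icc_ceil_floor _ hR').1 (card_Icc_ceil_floor _ hR').1 (by linarith)
    (by positivity)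

theorem square_subset_square {c z : ℝ × ℝ} {r R : ℝ} (h1 : |z.1 - c.1| + r ≤ R)
    (h2 : |z.2 - c.2| + r ≤ R) : square z r ⊆ square c R := by
  rintro p ⟨h3, h4⟩
  constructor
  · calc |p.1 - c.1| ≤ |p.1 - z.1| + |z.1 - c.1| := abs_sub_le _ _ _
      _ ≤ R := by linarith
  · calc |p.2 - c.2| ≤ |p.2 - z.2| + |z.2 - c.2| := abs_sub_le _ _ _
      _ ≤ R := by linarith

theorem norm_sub_starProjection_le {H : Type*} [NormedAddCommGroup H] [InnerProductSpace ℂ H]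
    (W : Submodule ℂ H) [W.HasOrthogonalProjection] (x : H) {w : H} (hw : w ∈ W) :
    ‖x - W.starProjection x‖ ≤ ‖x - w‖ := by
  rw [Submodule.starProjection_minimal]
  exact ciInf_le ⟨0, by rintro _ ⟨y, rfl⟩; exact norm_nonneg _⟩ (⟨w, hw⟩ : W)

theorem IsFrame.lattice_comparison {g : L2} {Λ : Set (ℝ × ℝ)} (hΛ : UniformlyDiscrete Λ)
    (hg : IsFrame (gaborSystem g Λ)) {ε : ℝ} (hε : 0 < ε) :
    ∃ R : ℝ, 0 < R ∧ ∀ (c : ℝ × ℝ) (r : ℝ), 0 ≤ r →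
      (1 - ε) * (latticePoints c r).card ≤ (Λ ∩ square c (r + R)).ncard := by
  classical
  obtain ⟨h, K, hK, hdual⟩ := hg.exists_dual
  obtain ⟨f, hf, hbox⟩ := exists_isSmoothWindow (half_pos hε)
  obtain ⟨R₀, hR₀, htail⟩ := hf.tail_small g hΛ (ε := (ε / (4 * K)) ^ 2) (by positivity)
  obtain ⟨M, hM⟩ := hΛ.exists_count_bound
  -- The extra 1 leaves room for the half-unit shift of the second window.
  refine ⟨R₀ + 1, by linarith, fun c r hr => ?_⟩
  have hfin := (hM c (r + (R₀ + 1)) (by linarith)).1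
  have hfin' : {p : Λ | (p : ℝ × ℝ) ∈ Λ ∩ square c (r + (R₀ + 1))}.Finite :=
    hfin.preimage Subtype.val_injective.injOn
  let s : Finset Λ := hfin'.toFinset
  let W : Submodule ℂ L2 := Submodule.span ℂ (s.image h : Finset L2)
  have hWdim : Module.finrank ℂ W ≤ (Λ ∩ square c (r + (R₀ + 1))).ncard := by
    refine (finrank_span_finset_le_card _).trans (Finset.card_image_le.trans ?_)
    rw [← Finset.card_map ⟨Subtype.val, Subtype.val_injective⟩, ← Set.ncard_coe_finset]
    refine Set.ncard_le_ncard ?_ hfin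
    intro p hp
    obtain ⟨q, hq, rfl⟩ := Finset.mem_map.1 (Finset.mem_coe.1 hp)
    exact (Set.Finite.mem_toFinset hfin').1 hq
  have hnear : ∀ z : ℝ × ℝ, square z R₀ ⊆ square c (r + (R₀ + 1)) →
      ‖atom f z - W.starProjection (atom f z)‖ ≤ ε / 4 := by
    intro z hz
    have := hdual (atom f z) W (ε / (4 * K)) (by positivity) (fun t ht => ?_)
    · calc _ ≤ K * (ε / (4 * K)) := this
        _ = ε / 4 := by field_simp
    · have h1 := htail z (t.map ⟨Subtype.val, Subtype.val_injective⟩) (fun p hp => ?_)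
      · rw [Finset.sum_map] at h1
        exact h1
      · obtain ⟨q, hq, rfl⟩ := Finset.mem_map.1 hp
        refine ⟨q.2, fun hqz => ht q hq ?_⟩
        refine Submodule.subset_span ?_
        rw [Finset.coe_image]
        exact ⟨q, (Set.Finite.mem_toFinset hfin').2 ⟨q.2, hz hqz⟩, rfl⟩
  have hlat : ∀ k : latticePoints c r,
      ‖latticeAtom k - W.starProjection (latticeAtom k)‖ ≤ ε := by
    rintro ⟨k, hk⟩
    obtain ⟨hk1, hk2⟩ := mem_latticePoints.1 hk
    simp only at hk1 hk2
    set z : ℝ × ℝ := (k.1, k.2) with hz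
    set e : L2 := box - (f + atom f (1 / 2, 0)) with he
    have h1 : ‖atom f z - W.starProjection (atom f z)‖ ≤ ε / 4 :=
      hnear z (square_subset_square (by simp only [hz]; linarith) (by simp only [hz]; linarith))
    have h2 : ‖atom f (z + (1 / 2, 0)) - W.starProjection (atom f (z + (1 / 2, 0)))‖ ≤ ε / 4 := by
      refine hnear _ (square_subset_square ?_ ?_)
      · have : |(z + (1 / 2, 0)).1 - c.1| ≤ |(k.1 : ℝ) - c.1| + |1 / 2| := by
          refine le_trans (le_of_eq ?_) (abs_add_le _ _)
          congr 1
          simp only [hz, Prod.fst_add]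
          ring
        rw [abs_of_pos (by norm_num : (0 : ℝ) < 1 / 2)] at this
        linarith
      · simp only [hz, Prod.snd_add, add_zero]
        linarith
    have h3 : ‖atom e z - W.starProjection (atom e z)‖ ≤ ε / 2 := by
      refine (norm_sub_starProjection_le W _ W.zero_mem).trans ?_
      rwa [sub_zero, norm_atom]
    -- The two smooth pieces cost ε/4 each and the remainder ε/2.
    have hdecomp : latticeAtom k = atom f z
        + phase (-((1 / 2, (0 : ℝ)).2 * z.1)) • atom f (z + (1 / 2, 0)) + atom e z := by
      rw [← atom_atom f z (1 / 2, 0), ← atom_add, ← atom_add, he, latticeAtom]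
      congr 1
      abel
    simp only
    rw [hdecomp, map_add, map_add, map_smul]
    set u := atom f z
    set v := atom f (z + (1 / 2, 0))
    set w := atom e z
    set θ := phase (-((1 / 2, (0 : ℝ)).2 * z.1)) with hθ
    have : u + θ • v + w - (W.starProjection u + θ • W.starProjection v + W.starProjection w)
        = (u - W.starProjection u) + θ • (v - W.starProjection v)
          + (w - W.starProjection w) := by
      rw [smul_sub]; abel
    rw [this]
    refine (norm_add₃_le).trans ?_
    rw [norm_smul, hθ, norm_phase, one_mul]
    linarith
  have hortho : ∀ i j : latticePoints c r, inner ℂ (latticeAtom i) (latticeAtom j)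
      = if i = j then (1 : ℂ) else 0 := by
    intro i j
    rw [orthonormal_iff_ite.1 orthonormal_latticeAtom]
    simp only [Subtype.coe_inj]
  -- An orthonormal family is its own biorthogonal system.
  have := card_le_finrank_of_biorthogonal hortho (C := 1)
    (fun i => (orthonormal_latticeAtom.1 i).le) W hlat
  rw [Fintype.card_coe, one_mul] at this
  exact this.trans (by exact_mod_cast hWdim)

/-! ### Approximation by lattice atoms and comparison for Riesz sequences -/

theorem latticePoints_mono {c : ℝ × ℝ} {r R : ℝ} (h : r ≤ R) :
    latticePoints c r ⊆ latticePoints c R := by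
  intro k hk
  rw [mem_latticePoints] at hk ⊢
  exact ⟨hk.1.trans h, hk.2.trans h⟩

/-- The span of the lattice atoms located in a square. -/
def latticeSpan (c : ℝ × ℝ) (R : ℝ) : Submodule ℂ L2 :=
  Submodule.span ℂ (latticeAtom '' (latticePoints c R : Set (ℤ × ℤ)))

theorem latticeAtom_mem_latticeSpan {c : ℝ × ℝ} {R : ℝ} {k : ℤ × ℤ} (hk : k ∈ latticePoints c R) :
    latticeAtom k ∈ latticeSpan c R :=
  Submodule.subset_span ⟨k, hk, rfl⟩

theorem latticeSpan_mono {c : ℝ × ℝ} {r R : ℝ} (h : r ≤ R) : latticeSpan c r ≤ latticeSpan c R :=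
  Submodule.span_mono (Set.image_mono (Finset.coe_subset.2 (latticePoints_mono h)))

instance (c : ℝ × ℝ) (R : ℝ) : FiniteDimensional ℂ (latticeSpan c R) :=
  FiniteDimensional.span_of_finite ℂ (Set.toFinite _)

theorem finrank_latticeSpan_le (c : ℝ × ℝ) (R : ℝ) :
    Module.finrank ℂ (latticeSpan c R) ≤ (latticePoints c R).card := by
  classical
  rw [latticeSpan, ← Finset.coe_image]
  exact (finrank_span_finset_le_card _).trans Finset.card_image_le

theorem exists_mem_latticeSpan_near (x : L2) {ε : ℝ} (hε : 0 < ε) :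
    ∃ N : ℕ, ∃ y ∈ latticeSpan 0 N, ‖x - y‖ < ε := by
  have hs := latticeBasis.hasSum_repr x
  obtain ⟨s, hs⟩ := (Metric.tendsto_nhds.1 hs ε hε).exists
  obtain ⟨N, hN⟩ : ∃ N : ℕ, ∀ k ∈ s, k.1.natAbs ≤ N ∧ k.2.natAbs ≤ N := by
    refine ⟨∑ k ∈ s, (k.1.natAbs + k.2.natAbs), fun k hk => ?_⟩
    have := Finset.single_le_sum (f := fun k : ℤ × ℤ => k.1.natAbs + k.2.natAbs)
      (fun i _ => Nat.zero_le _) hk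
    omega
  refine ⟨N, _, ?_, by rwa [dist_comm, dist_eq_norm] at hs⟩
  refine Submodule.sum_mem _ fun k hk => Submodule.smul_mem _ _ ?_
  rw [latticeBasis_apply]
  apply latticeAtom_mem_latticeSpan
  rw [mem_latticePoints]
  obtain ⟨h1, h2⟩ := hN k hk
  have cast : ∀ a : ℤ, a.natAbs ≤ N → |(a : ℝ)| ≤ N := by
    intro a ha
    have : ((a.natAbs : ℤ) : ℝ) ≤ N := by exact_mod_cast ha
    rwa [Int.natCast_natAbs, Int.cast_abs] at this
  constructor
  · simpa using cast _ h1
  · simpa using cast _ h2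

/-- The sets of positions approximable from a given box are open, increase with the box and cover
everything, so compactness selects one box. -/
theorem exists_uniform_latticeSpan_near (g : L2) {ε : ℝ} (hε : 0 < ε) :
    ∃ N : ℕ, ∀ w ∈ Set.Icc (0 : ℝ) 1 ×ˢ Set.Icc (0 : ℝ) 1,
      ∃ y ∈ latticeSpan 0 N, ‖atom g w - y‖ < ε := by
  have hcomp : IsCompact (Set.Icc (0 : ℝ) 1 ×ˢ Set.Icc (0 : ℝ) 1) :=
    isCompact_Icc.prod isCompact_Icc
  let U : ℕ → Set (ℝ × ℝ) := fun N => ⋃ y ∈ latticeSpan 0 N, {w | ‖atom g w - y‖ < ε}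
  have hU : ∀ N, IsOpen (U N) := fun N => isOpen_biUnion fun y _ =>
    isOpen_lt ((continuous_atom g).sub continuous_const).norm continuous_const
  have hmono : Monotone U := by
    intro m n hmn
    exact Set.biUnion_subset_biUnion_left (latticeSpan_mono (by exact_mod_cast hmn))
  obtain ⟨N, hN⟩ := hcomp.elim_directed_cover U hU (fun w _ => by
    obtain ⟨N, y, hy, hlt⟩ := exists_mem_latticeSpan_near (atom g w) hε
    exact Set.mem_iUnion.2 ⟨N, Set.mem_biUnion hy hlt⟩) hmono.directed_le
  refine ⟨N, fun w hw => ?_⟩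
  obtain ⟨y, hy, hlt⟩ := Set.mem_iUnion₂.1 (hN hw)
  exact ⟨y, hy, hlt⟩

theorem atom_latticeAtom (k d : ℤ × ℤ) :
    atom (latticeAtom d) (k.1, k.2) = phase (-(d.2 * k.1)) • latticeAtom (k + d) := by
  rw [latticeAtom, atom_atom, latticeAtom]
  simp

theorem atom_mem_latticeSpan {N : ℝ} {y : L2} (hy : y ∈ latticeSpan 0 N) {k : ℤ × ℤ} {c : ℝ × ℝ}
    {R : ℝ} (hk : square ((k.1 : ℝ), (k.2 : ℝ)) N ⊆ square c R) :
    atom y (k.1, k.2) ∈ latticeSpan c R := by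
  have : (latticeSpan 0 N).map (shiftIsometry ((k.1 : ℝ), (k.2 : ℝ))).toLinearMap
      ≤ latticeSpan c R := by
    rw [latticeSpan, Submodule.map_span, Submodule.span_le]
    rintro _ ⟨_, ⟨d, hd, rfl⟩, rfl⟩
    rw [Finset.mem_coe] at hd
    change atom (latticeAtom d) (k.1, k.2) ∈ latticeSpan c R
    rw [atom_latticeAtom]
    refine Submodule.smul_mem _ _ (latticeAtom_mem_latticeSpan ?_)
    rw [mem_latticePoints] at hd ⊢
    apply hk
    constructor
    · simpa using hd.1
    · simpa using hd.2
  exact this ⟨y, hy, rfl⟩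

theorem exists_latticeSpan_approximation (g : L2) {ε : ℝ} (hε : 0 < ε) :
    ∃ R : ℝ, 0 < R ∧ ∀ (c : ℝ × ℝ) (r : ℝ), ∀ p ∈ square c r,
      ‖atom g p - (latticeSpan c (r + R)).starProjection (atom g p)‖ ≤ ε := by
  obtain ⟨N, hN⟩ := exists_uniform_latticeSpan_near g hε
  -- N accounts for the box, 1 for replacing p by its integer part.
  refine ⟨N + 1, by positivity, fun c r p hp => ?_⟩
  obtain ⟨hp1, hp2⟩ := hp
  obtain ⟨y, hy, hlt⟩ := hN (Int.fract p.1, Int.fract p.2)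
    ⟨⟨Int.fract_nonneg _, (Int.fract_lt_one _).le⟩, ⟨Int.fract_nonneg _, (Int.fract_lt_one _).le⟩⟩
  have hdist : ∀ x a : ℝ, |(⌊x⌋ : ℝ) - a| ≤ |x - a| + 1 := by
    intro x a
    have h1 : (⌊x⌋ : ℝ) - a = (x - a) + -Int.fract x := by
      rw [Int.fract]; ring
    rw [h1]
    refine (abs_add_le _ _).trans ?_
    rw [abs_neg, abs_of_nonneg (Int.fract_nonneg x)]
    linarith [Int.fract_lt_one x]
  have hmem : atom y (⌊p.1⌋, ⌊p.2⌋) ∈ latticeSpan c (r + (N + 1)) := by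
    refine atom_mem_latticeSpan (k := (⌊p.1⌋, ⌊p.2⌋)) hy (square_subset_square ?_ ?_)
    · linarith [hdist p.1 c.1]
    · linarith [hdist p.2 c.2]
  set a : ℝ := Int.fract p.2 * ⌊p.1⌋ with ha
  have hatom : atom g p
      = phase a • atom (atom g (Int.fract p.1, Int.fract p.2)) (⌊p.1⌋, ⌊p.2⌋) := by
    have h2 : (((⌊p.1⌋ : ℝ), (⌊p.2⌋ : ℝ)) + (Int.fract p.1, Int.fract p.2) : ℝ × ℝ) = p := by
      ext <;> simp
    rw [atom_atom, smul_smul, ← phase_add, h2, ← ha, add_neg_cancel, phase_zero, one_smul]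
  refine (norm_sub_starProjection_le _ _ (Submodule.smul_mem _ (phase a) hmem)).trans ?_
  rw [hatom, ← smul_sub, ← atom_sub, norm_smul, norm_phase, one_mul, norm_atom]
  exact hlt.le

theorem IsRieszSequence.lattice_comparison {g : L2} {Λ : Set (ℝ × ℝ)} (hΛ : UniformlyDiscrete Λ)
    (hg : IsRieszSequence (gaborSystem g Λ)) {ε : ℝ} (hε : 0 < ε) :
    ∃ R : ℝ, 0 < R ∧ ∀ (c : ℝ × ℝ) (r : ℝ), 0 ≤ r →
      (1 - ε) * (Λ ∩ square c r).ncard ≤ (latticePoints c (r + R)).card := by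
  classical
  obtain ⟨v, C, hC, hvC, hv⟩ := hg.exists_biorthogonal
  -- Dividing by C + 1 avoids a zero denominator and still gives total loss at most ε.
  obtain ⟨R, hR, happrox⟩ := exists_latticeSpan_approximation g (ε := ε / (C + 1)) (by positivity)
  obtain ⟨M, hM⟩ := hΛ.exists_count_bound
  refine ⟨R, hR, fun c r hr => ?_⟩
  have hfin := (hM c r hr).1
  let s : Finset (ℝ × ℝ) := hfin.toFinset
  have hs : ∀ p ∈ s, p ∈ Λ ∩ square c r := fun p hp => (Set.Finite.mem_toFinset hfin).1 hp
  have hbi : ∀ p q : s, inner ℂ (v ⟨p, (hs p p.2).1⟩) (atom g q)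
      = if p = q then (1 : ℂ) else 0 := by
    intro p q
    have := hv ⟨p, (hs p p.2).1⟩ ⟨q, (hs q q.2).1⟩
    simp only [gaborSystem] at this
    rw [this]
    simp only [Subtype.mk.injEq, Subtype.coe_inj]
  have hcard := card_le_finrank_of_biorthogonal hbi (C := C) (fun p => hvC _)
    (latticeSpan c (r + R)) (fun p => happrox c r p (hs p p.2).2)
  rw [Fintype.card_coe, ← Set.ncard_eq_toFinset_card _ hfin] at hcard
  have hCε : C * (ε / (C + 1)) ≤ ε := by
    rw [← mul_div_assoc, div_le_iff₀ (by positivity)]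
    nlinarith
  calc (1 - ε) * ((Λ ∩ square c r).ncard : ℝ)
      ≤ (1 - C * (ε / (C + 1))) * (Λ ∩ square c r).ncard := by gcongr
    _ ≤ Module.finrank ℂ (latticeSpan c (r + R)) := hcard
    _ ≤ _ := by exact_mod_cast finrank_latticeSpan_le _ _

/-! ### Fekete's lemma, tilings by squares and existence of densities -/

theorem tendsto_const_div_atTop (a : ℝ) : Tendsto (fun R : ℝ => a / R) atTop (𝓝 0) :=
  tendsto_const_nhds.div_atTop tendsto_id

/-- Fekete's lemma for functions that are subadditive under tiling by squares. -/
theorem exists_tendsto_of_tiling_le {F : ℝ → ℝ} (h0 : ∀ R, 0 ≤ F R)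
    (h : ∀ R₀ > (0 : ℝ), ∀ R > (0 : ℝ), ∀ k : ℕ, R ≤ k * R₀ → F R ≤ k ^ 2 * F R₀) :
    ∃ L : ℝ, Tendsto (fun R => F R / (2 * R) ^ 2) atTop (𝓝 L) := by
  set S : Set ℝ := (fun R => F R / (2 * R) ^ 2) '' Set.Ioi 0 with hS
  have hne : S.Nonempty := ⟨_, 1, by simp, rfl⟩
  have hbdd : BddBelow S := by
    refine ⟨0, ?_⟩
    rintro _ ⟨R, -, rfl⟩
    exact div_nonneg (h0 R) (by positivity)
  -- Subadditivity identifies the limit with the infimum; dually, superadditivity gives a supremum.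
  refine ⟨sInf S, ?_⟩
  rw [tendsto_order]
  constructor
  · intro a ha
    filter_upwards [eventually_gt_atTop 0] with R hR
    exact ha.trans_le (csInf_le hbdd ⟨R, hR, rfl⟩)
  · intro a ha
    obtain ⟨_, ⟨R₀, hR₀, rfl⟩, hlt⟩ := exists_lt_of_csInf_lt hne ha
    rw [Set.mem_Ioi] at hR₀
    simp only at hlt
    have hlim : Tendsto (fun R : ℝ => (1 + R₀ / R) ^ 2 * (F R₀ / (2 * R₀) ^ 2)) atTop
        (𝓝 ((1 + 0) ^ 2 * (F R₀ / (2 * R₀) ^ 2))) :=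
      ((tendsto_const_nhds.add (tendsto_const_div_atTop R₀)).pow 2).mul tendsto_const_nhds
    have hlt' : (1 + 0) ^ 2 * (F R₀ / (2 * R₀) ^ 2) < a := by simpa using hlt
    filter_upwards [hlim.eventually (gt_mem_nhds hlt'), eventually_gt_atTop 0] with R h1 hR
    refine lt_of_le_of_lt ?_ h1
    have hk1 := Nat.le_ceil (R / R₀)
    have hk2 := Nat.ceil_lt_add_one (div_nonneg hR.le hR₀.le)
    set k := ⌈R / R₀⌉₊
    rw [div_le_iff₀ hR₀] at hk1
    have h2 := h R₀ hR₀ R hR k hk1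
    rw [div_le_iff₀ (by positivity)]
    have hkR : (k : ℝ) ≤ (1 + R₀ / R) * (R / R₀) := by
      have : (1 + R₀ / R) * (R / R₀) = R / R₀ + 1 := by field_simp
      rw [this]; exact hk2.le
    calc F R ≤ (k : ℝ) ^ 2 * F R₀ := h2
      _ ≤ ((1 + R₀ / R) * (R / R₀)) ^ 2 * F R₀ := by gcongr; exact h0 R₀
      _ = _ := by field_simp

/-- Fekete's lemma for functions that are superadditive under tiling by squares. -/
theorem exists_tendsto_of_le_tiling {F : ℝ → ℝ} (h0 : ∀ R, 0 ≤ F R) {B : ℝ}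
    (hB : ∀ R, 1 ≤ R → F R / (2 * R) ^ 2 ≤ B)
    (h : ∀ R₀ > (0 : ℝ), ∀ R > (0 : ℝ), ∀ k : ℕ, k * R₀ < R → k ^ 2 * F R₀ ≤ F R) :
    ∃ L : ℝ, Tendsto (fun R => F R / (2 * R) ^ 2) atTop (𝓝 L) := by
  set S : Set ℝ := (fun R => F R / (2 * R) ^ 2) '' Set.Ici 1 with hS
  have hne : S.Nonempty := ⟨_, 1, by simp, rfl⟩
  have hbdd : BddAbove S := by
    refine ⟨B, ?_⟩
    rintro _ ⟨R, hR, rfl⟩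
    exact hB R hR
  refine ⟨sSup S, ?_⟩
  rw [tendsto_order]
  constructor
  · intro a ha
    obtain ⟨_, ⟨R₀, hR₀, rfl⟩, hlt⟩ := exists_lt_of_lt_csSup hne ha
    rw [Set.mem_Ici] at hR₀
    have hR₀' : 0 < R₀ := by linarith
    simp only at hlt
    have hlim : Tendsto (fun R : ℝ => (1 - R₀ / R) ^ 2 * (F R₀ / (2 * R₀) ^ 2)) atTop
        (𝓝 ((1 - 0) ^ 2 * (F R₀ / (2 * R₀) ^ 2))) :=
      ((tendsto_const_nhds.sub (tendsto_const_div_atTop R₀)).pow 2).mul tendsto_const_nhds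
    have hlt' : a < (1 - 0) ^ 2 * (F R₀ / (2 * R₀) ^ 2) := by simpa using hlt
    filter_upwards [hlim.eventually (lt_mem_nhds hlt'), eventually_ge_atTop R₀] with R h1 hRR
    have hR : 0 < R := by linarith
    refine h1.trans_le ?_
    have hc1 := Nat.le_ceil (R / R₀)
    have hc2 := Nat.ceil_lt_add_one (div_nonneg hR.le hR₀'.le)
    have hc3 : 1 ≤ ⌈R / R₀⌉₊ := Nat.one_le_ceil_iff.2 (by positivity)
    -- Here k = ⌈R / R₀⌉ - 1, the largest k with k R₀ < R strictly.
    obtain ⟨k, hk⟩ := Nat.exists_eq_add_of_le hc3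
    rw [hk] at hc1 hc2
    push_cast at hc1 hc2
    have hk2 : (k : ℝ) * R₀ < R := by
      rw [← lt_div_iff₀ hR₀']; linarith
    have h2 := h R₀ hR₀' R hR k hk2
    rw [le_div_iff₀ (by positivity)]
    have hkR : (1 - R₀ / R) * (R / R₀) ≤ k := by
      have : (1 - R₀ / R) * (R / R₀) = R / R₀ - 1 := by field_simp
      rw [this]; linarith
    have hpos : 0 ≤ (1 - R₀ / R) * (R / R₀) := by
      have : R₀ / R ≤ 1 := (div_le_one hR).2 hRR
      have : 0 ≤ 1 - R₀ / R := by linarith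
      positivity
    calc _ = ((1 - R₀ / R) * (R / R₀)) ^ 2 * F R₀ := by field_simp
      _ ≤ (k : ℝ) ^ 2 * F R₀ := by gcongr; exact h0 R₀
      _ ≤ F R := h2
  · intro a ha
    filter_upwards [eventually_ge_atTop 1] with R hR
    exact (le_csSup hbdd ⟨R, hR, rfl⟩).trans_lt ha

theorem exists_subinterval_cover {a x R₀ R : ℝ} (hR₀ : 0 < R₀) (hR : 0 < R) {k : ℕ}
    (hk : R ≤ k * R₀) (hx : |x - a| ≤ R) :
    ∃ i ∈ Finset.range k, |x - (a - k * R₀ + (2 * i + 1) * R₀)| ≤ R₀ := by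
  rw [abs_le] at hx
  have hk0 : 0 < k := by
    rcases Nat.eq_zero_or_pos k with rfl | h
    · simp at hk; linarith
    · exact h
  set y : ℝ := (x - a + k * R₀) / (2 * R₀) with hy
  have hy' : y * (2 * R₀) = x - a + k * R₀ := by rw [hy]; field_simp
  have hy0 : 0 ≤ y := div_nonneg (by linarith) (by linarith)
  have hyk : y ≤ k := by rw [hy, div_le_iff₀ (by linarith)]; linarith
  have h1 : ⌈y⌉₊ ≤ k := Nat.ceil_le.2 hyk
  have h2 := Nat.le_ceil y
  have h3 := Nat.ceil_lt_add_one hy0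
  -- The ceiling keeps the right endpoint y = k in the last interval; truncated subtraction puts y =
  -- 0 in the first.
  refine ⟨⌈y⌉₊ - 1, Finset.mem_range.2 (by omega), ?_⟩
  have h4 : ((⌈y⌉₊ - 1 : ℕ) : ℝ) ≤ y ∧ y ≤ ((⌈y⌉₊ - 1 : ℕ) : ℝ) + 1 := by
    rcases Nat.eq_zero_or_pos ⌈y⌉₊ with h | h
    · rw [h] at h2
      simp only [h, Nat.zero_sub, Nat.cast_zero] at h2 ⊢
      constructor <;> linarith
    · rw [Nat.cast_sub h]
      push_cast
      constructor <;> linarith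
  set i : ℕ := ⌈y⌉₊ - 1
  have h5 := mul_le_mul_of_nonneg_right h4.1 (by linarith : 0 ≤ 2 * R₀)
  have h6 := mul_le_mul_of_nonneg_right h4.2 (by linarith : 0 ≤ 2 * R₀)
  rw [abs_le]
  constructor <;> linarith

/-- The centers of the `k × k` grid of squares with half side `s` centered around `c`. -/
def gridCenter (c : ℝ × ℝ) (s : ℝ) (k : ℕ) (i : ℕ × ℕ) : ℝ × ℝ :=
  (c.1 - k * s + (2 * i.1 + 1) * s, c.2 - k * s + (2 * i.2 + 1) * s)

/-- The index set of a `k × k` grid. -/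
def gridIndex (k : ℕ) : Finset (ℕ × ℕ) := Finset.range k ×ˢ Finset.range k

theorem card_gridIndex (k : ℕ) : (gridIndex k).card = k ^ 2 := by
  simp [gridIndex, sq]

theorem ncard_square_le_grid {Λ : Set (ℝ × ℝ)} (hfin : ∀ c R, 0 ≤ R → (Λ ∩ square c R).Finite)
    {N : ℕ} {R₀ R : ℝ} (hR₀ : 0 < R₀) (hR : 0 < R) {k : ℕ} (hk : R ≤ k * R₀)
    (hN : ∀ c, (Λ ∩ square c R₀).ncard ≤ N) (c : ℝ × ℝ) :
    (Λ ∩ square c R).ncard ≤ k ^ 2 * N := by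
  classical
  let f : ℕ × ℕ → Finset (ℝ × ℝ) := fun i => (hfin (gridCenter c R₀ k i) R₀ hR₀.le).toFinset
  have hsub : Λ ∩ square c R ⊆ ((gridIndex k).biUnion f : Finset (ℝ × ℝ)) := by
    rintro p ⟨hp, h1, h2⟩
    obtain ⟨i, hi, hi'⟩ := exists_subinterval_cover hR₀ hR hk h1
    obtain ⟨j, hj, hj'⟩ := exists_subinterval_cover hR₀ hR hk h2
    rw [Finset.mem_coe, Finset.mem_biUnion]
    refine ⟨(i, j), Finset.mem_product.2 ⟨hi, hj⟩, ?_⟩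
    rw [Set.Finite.mem_toFinset]
    exact ⟨hp, hi', hj'⟩
  refine (Set.ncard_le_ncard hsub (Finset.finite_toSet _)).trans ?_
  rw [Set.ncard_coe_finset, ← card_gridIndex]
  refine Finset.card_biUnion_le_card_mul _ _ _ fun i _ => ?_
  rw [← Set.ncard_eq_toFinset_card _ (hfin _ R₀ hR₀.le)]
  exact hN _

theorem eq_of_grid_close {a x s R₀ : ℝ} (hs : R₀ < s) {k i j : ℕ}
    (hi : |x - (a - k * s + (2 * i + 1) * s)| ≤ R₀)
    (hj : |x - (a - k * s + (2 * j + 1) * s)| ≤ R₀) : i = j := by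
  have hs0 : 0 < s := (abs_nonneg _).trans hi |>.trans_lt hs
  rw [abs_le] at hi hj
  have key : ∀ u v : ℕ, (u : ℝ) * s < v * s + s → u ≤ v := by
    intro u v h
    have : (u : ℝ) < v + 1 := by
      by_contra hcon
      nlinarith [mul_le_mul_of_nonneg_right (not_lt.1 hcon) hs0.le]
    have : u < v + 1 := by exact_mod_cast this
    omega
  exact le_antisymm (key i j (by linarith)) (key j i (by linarith))

theorem grid_interval_subset {a x s R₀ : ℝ} (hs : R₀ ≤ s) {k i : ℕ} (hik : i < k)
    (hi : |x - (a - k * s + (2 * i + 1) * s)| ≤ R₀) : |x - a| ≤ k * s := by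
  have hs0 : 0 ≤ s := (abs_nonneg _).trans hi |>.trans hs
  rw [abs_le] at hi ⊢
  have h1 : ((i : ℝ) + 1) * s ≤ k * s := by
    have : (i : ℝ) + 1 ≤ k := by exact_mod_cast hik
    gcongr
  have h2 : 0 ≤ (i : ℝ) * s := by positivity
  constructor <;> linarith

theorem grid_le_ncard_square {Λ : Set (ℝ × ℝ)} (hfin : ∀ c R, 0 ≤ R → (Λ ∩ square c R).Finite)
    {N : ℕ} {R₀ R : ℝ} (hR₀ : 0 < R₀) (hR : 0 < R) {k : ℕ} (hk : k * R₀ < R)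
    (hN : ∀ c, N ≤ (Λ ∩ square c R₀).ncard) (c : ℝ × ℝ) :
    k ^ 2 * N ≤ (Λ ∩ square c R).ncard := by
  classical
  rcases Nat.eq_zero_or_pos k with rfl | hk0
  · simp
  have hk0' : (0 : ℝ) < k := by exact_mod_cast hk0
  -- Centers are spaced by 2s with s > R₀, so the closed squares are disjoint and no boundary point
  -- is counted twice.
  set s : ℝ := R / k with hs
  have hRs : R₀ < s := by rw [hs, lt_div_iff₀ hk0']; linarith
  have hks : k * s = R := by rw [hs]; field_simp
  let f : ℕ × ℕ → Finset (ℝ × ℝ) := fun i => (hfin (gridCenter c s k i) R₀ hR₀.le).toFinset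
  have hmem : ∀ i p, p ∈ f i ↔ p ∈ Λ ∧ p ∈ square (gridCenter c s k i) R₀ := by
    intro i p
    simp only [f, Set.Finite.mem_toFinset, Set.mem_inter_iff]
  have hsub : (((gridIndex k).biUnion f : Finset (ℝ × ℝ)) : Set (ℝ × ℝ)) ⊆ Λ ∩ square c R := by
    intro p hp
    rw [Finset.mem_coe, Finset.mem_biUnion] at hp
    obtain ⟨i, hi, hp⟩ := hp
    obtain ⟨hp, h1, h2⟩ := (hmem i p).1 hp
    obtain ⟨hi1, hi2⟩ := Finset.mem_product.1 hi
    refine ⟨hp, ?_, ?_⟩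
    · have := grid_interval_subset hRs.le (Finset.mem_range.1 hi1) h1
      rwa [hks] at this
    · have := grid_interval_subset hRs.le (Finset.mem_range.1 hi2) h2
      rwa [hks] at this
  have hdisj : ((gridIndex k : Finset (ℕ × ℕ)) : Set (ℕ × ℕ)).PairwiseDisjoint f := by
    intro i _ j _ hij
    rw [Function.onFun, Finset.disjoint_left]
    intro p hpi hpj
    apply hij
    obtain ⟨-, h1, h2⟩ := (hmem i p).1 hpi
    obtain ⟨-, h3, h4⟩ := (hmem j p).1 hpj
    exact Prod.ext (eq_of_grid_close hRs h1 h3) (eq_of_grid_close hRs h2 h4)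
  have h1 := Set.ncard_le_ncard hsub (hfin c R hR.le)
  rw [Set.ncard_coe_finset, Finset.card_biUnion hdisj] at h1
  refine le_trans ?_ h1
  rw [← card_gridIndex, ← smul_eq_mul]
  refine Finset.card_nsmul_le_sum _ _ _ fun i _ => ?_
  rw [← Set.ncard_eq_toFinset_card _ (hfin _ R₀ hR₀.le)]
  exact hN _

theorem tendsto_ratio_sq (a : ℝ) :
    Tendsto (fun R : ℝ => (2 * R + a) ^ 2 / (2 * R) ^ 2) atTop (𝓝 1) := by
  have h1 : Tendsto (fun R : ℝ => (1 + a / 2 / R) ^ 2) atTop (𝓝 ((1 + 0) ^ 2)) :=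
    (tendsto_const_nhds.add (tendsto_const_div_atTop (a / 2))).pow 2
  rw [add_zero, one_pow] at h1
  refine h1.congr' ?_
  filter_upwards [eventually_gt_atTop 0] with R hR
  field_simp

theorem le_one_of_forall_one_sub_mul_le {L : ℝ} (h : ∀ ε : ℝ, 0 < ε → (1 - ε) * L ≤ 1) :
    L ≤ 1 := by
  have h1 : Tendsto (fun ε : ℝ => (1 - ε) * L) (𝓝[>] 0) (𝓝 ((1 - 0) * L)) := by
    refine Tendsto.mono_left ?_ nhdsWithin_le_nhds
    exact Continuous.tendsto (by fun_prop) 0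
  rw [sub_zero, one_mul] at h1
  exact le_of_tendsto h1 (by filter_upwards [self_mem_nhdsWithin] with ε hε using h ε hε)

theorem tendsto_count_div {u : ℝ → ℕ∞} (hu : ∀ R, 0 ≤ R → u R ≠ ⊤) {L : ℝ}
    (h : Tendsto (fun R => ((u R).toNat : ℝ) / (2 * R) ^ 2) atTop (𝓝 L)) :
    Tendsto (fun R : ℝ => (u R : ℝ≥0∞) / ENNReal.ofReal ((2 * R) ^ 2)) atTop
      (𝓝 (L.toNNReal : ℝ≥0∞)) := by
  have h1 := ENNReal.tendsto_ofReal h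
  refine h1.congr' ?_
  filter_upwards [eventually_gt_atTop 0] with R hR
  rw [ENNReal.ofReal_div_of_pos (by positivity), ENNReal.ofReal_natCast]
  congr 1
  conv_rhs => rw [← ENat.natCast_toNat (hu R hR.le)]
  rw [ENat.toENNReal_coe]

section Counts

variable {Λ : Set (ℝ × ℝ)}

theorem minCount_ne_top (hfin : ∀ c R, 0 ≤ R → (Λ ∩ square c R).Finite) {R : ℝ} (hR : 0 ≤ R) :
    minCount Λ R ≠ ⊤ :=
  ((iInf_le _ (0 : ℝ × ℝ)).trans_lt (hfin 0 R hR).encard_lt_top).ne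

theorem toNat_minCount_le (hfin : ∀ c R, 0 ≤ R → (Λ ∩ square c R).Finite) {R : ℝ} (hR : 0 ≤ R)
    (c : ℝ × ℝ) : (minCount Λ R).toNat ≤ (Λ ∩ square c R).ncard :=
  ENat.toNat_le_toNat (iInf_le _ c) (hfin c R hR).encard_lt_top.ne

theorem exists_ncard_eq_minCount (Λ : Set (ℝ × ℝ)) (R : ℝ) :
    ∃ c, (Λ ∩ square c R).ncard = (minCount Λ R).toNat := by
  obtain ⟨c, hc⟩ := ENat.exists_eq_iInf fun c : ℝ × ℝ => (Λ ∩ square c R).encard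
  exact ⟨c, congrArg ENat.toNat hc⟩

theorem maxCount_ne_top {N R : ℝ} (hfin : ∀ c, (Λ ∩ square c R).Finite)
    (hN : ∀ c, ((Λ ∩ square c R).ncard : ℝ) ≤ N) : maxCount Λ R ≠ ⊤ := by
  have h : maxCount Λ R ≤ (⌊N⌋₊ : ℕ∞) := by
    refine iSup_le fun c => ?_
    rw [← (hfin c).cast_ncard_eq]
    exact_mod_cast Nat.le_floor (hN c)
  exact (h.trans_lt (ENat.natCast_lt_top _)).ne

theorem ncard_le_toNat_maxCount {R : ℝ} (h : maxCount Λ R ≠ ⊤) (c : ℝ × ℝ) :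
    (Λ ∩ square c R).ncard ≤ (maxCount Λ R).toNat :=
  ENat.toNat_le_toNat (le_iSup (fun c : ℝ × ℝ => (Λ ∩ square c R).encard) c) h

theorem exists_ncard_eq_maxCount {R : ℝ} (h : maxCount Λ R ≠ ⊤) :
    ∃ c, (Λ ∩ square c R).ncard = (maxCount Λ R).toNat := by
  obtain ⟨c, hc⟩ := ENat.exists_eq_iSup_of_lt_top (f := fun c : ℝ × ℝ => (Λ ∩ square c R).encard)
    h.lt_top
  exact ⟨c, congrArg ENat.toNat hc⟩

end Counts

end Gabor

end

/-! ### The density theorem -/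

open Gabor in
theorem theoremA (g : Gabor.L2) (Λ : Set (ℝ × ℝ)) (hΛ : Gabor.UniformlyDiscrete Λ) :
    ∃ Dplus Dminus : ℝ≥0,
      Gabor.HasUpperDensity Λ Dplus ∧ Gabor.HasLowerDensity Λ Dminus ∧
      (Gabor.IsRieszSequence (Gabor.gaborSystem g Λ) → Dplus ≤ 1) ∧
      (Gabor.IsFrame (Gabor.gaborSystem g Λ) → 1 ≤ Dminus) := by
  obtain ⟨M, hM⟩ := hΛ.exists_count_bound
  have hfin : ∀ c R, 0 ≤ R → (Λ ∩ square c R).Finite := fun c R hR => (hM c R hR).1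
  have hmax : ∀ R, 0 ≤ R → maxCount Λ R ≠ ⊤ := fun R hR =>
    maxCount_ne_top (fun c => hfin c R hR) (fun c => (hM c R hR).2)
  obtain ⟨Lp, hLp⟩ := exists_tendsto_of_tiling_le
    (F := fun R => ((maxCount Λ R).toNat : ℝ)) (fun _ => Nat.cast_nonneg _)
    (fun R₀ hR₀ R hR k hk => by
      obtain ⟨c, hc⟩ := exists_ncard_eq_maxCount (hmax R hR.le)
      rw [← hc]
      exact_mod_cast ncard_square_le_grid hfin hR₀ hR hk
        (ncard_le_toNat_maxCount (hmax R₀ hR₀.le)) c)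
  obtain ⟨Lm, hLm⟩ := exists_tendsto_of_le_tiling
    (F := fun R => ((minCount Λ R).toNat : ℝ)) (B := ((M : ℝ) + 1) ^ 2)
    (fun _ => Nat.cast_nonneg _)
    (fun R hR => by
      have hR0 : 0 ≤ R := by linarith
      rw [div_le_iff₀ (by positivity)]
      calc ((minCount Λ R).toNat : ℝ) ≤ (Λ ∩ square 0 R).ncard := by
            exact_mod_cast toNat_minCount_le hfin hR0 0
        _ ≤ (2 * M * R + 2) ^ 2 := (hM 0 R hR0).2
        _ ≤ (2 * M * R + 2 * R) ^ 2 := by gcongr; linarith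
        _ = _ := by ring)
    (fun R₀ hR₀ R hR k hk => by
      obtain ⟨c, hc⟩ := exists_ncard_eq_minCount Λ R
      rw [← hc]
      exact_mod_cast grid_le_ncard_square hfin hR₀ hR hk (toNat_minCount_le hfin hR₀.le) c)
  refine ⟨Lp.toNNReal, Lm.toNNReal, tendsto_count_div hmax hLp,
    tendsto_count_div (fun R hR => minCount_ne_top hfin hR) hLm, fun hg => ?_, fun hg => ?_⟩
  · rw [Real.toNNReal_le_one]
    refine le_one_of_forall_one_sub_mul_le fun ε hε => ?_
    obtain ⟨R, hR, hcomp⟩ := hg.lattice_comparison hΛ hε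
    refine le_of_tendsto_of_tendsto (hLp.const_mul (1 - ε)) (tendsto_ratio_sq (2 * R + 1)) ?_
    filter_upwards [eventually_gt_atTop 0] with r hr
    obtain ⟨c, hc⟩ := exists_ncard_eq_maxCount (hmax r hr.le)
    rw [← mul_div_assoc, ← hc]
    gcongr
    refine (hcomp c r hr.le).trans ((card_latticePoints_le c (by linarith)).trans (le_of_eq ?_))
    ring
  · rw [Real.one_le_toNNReal]
    have key : ∀ ε : ℝ, 0 < ε → 1 - ε ≤ Lm := by
      intro ε hε
      obtain ⟨R, hR, hcomp⟩ := hg.lattice_comparison hΛ hε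
      -- For ε ≥ 1 the bound follows from nonnegativity; below, 1 - ε must be positive to multiply
      -- inequalities.
      rcases le_or_gt 1 ε with h1 | h1
      · have : 0 ≤ Lm := ge_of_tendsto' hLm fun R => by positivity
        linarith
      have h2 := (tendsto_ratio_sq (-2 * R - 1)).const_mul (1 - ε)
      rw [mul_one] at h2
      refine le_of_tendsto_of_tendsto h2 hLm ?_
      filter_upwards [eventually_ge_atTop (R + 1)] with r hr
      obtain ⟨c, hc⟩ := exists_ncard_eq_minCount Λ r
      rw [← mul_div_assoc, ← hc]
      gcongr
      have h3 := hcomp c (r - R) (by linarith)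
      rw [sub_add_cancel] at h3
      refine le_trans ?_ h3
      have h4 := le_card_latticePoints c (R := r - R) (by linarith)
      have h5 : (2 * r + (-2 * R - 1)) ^ 2 = (2 * (r - R) - 1) ^ 2 := by ring
      rw [h5]
      exact mul_le_mul_of_nonneg_left h4 (by linarith)
    exact le_of_forall_pos_le_add fun ε hε => by linarith [key ε hε]
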